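/- **Notation.** Let $p\in\mathbb N_0$ and $d_{\mathrm{refl}}(p)=\lfloor (p+2)/3\rfloor$. Let $\widehat T=\{x\in\mathbb R^2: x_1,x_2\ge 0,\ x_1+x_2\le 1\}$. For $0\le k\le n$ let $$b_{n,k}(x_1,x_2)=(x_1+x_2)^k\,P^{(0,2k+1)}_{n-k}\bigl(2(x_1+x_2)-1\bigr)\,P_k^{(0,0)}\Bigl(\tfrac{x_1-x_2}{x_1+x_2}\Bigr),$$ where $P_m^{(\alpha,\beta)}$ is the Jacobi polynomial with $P_m^{(\alpha,\beta)}(1)=\frac{(\alpha+1)_m}{m!}$ (the function $b_{n,k}$ is a polynomial). For $0\le k\le d_{\mathrm{refl}}(p)-1$ put $$b^{\mathrm{refl}}_{p,k}(x_1,x_2)=\tfrac13\bigl(2b_{p,2k}(x_1,x_2)-b_{p,2k}(x_2,1-x_1-x_2)-b_{p,2k}(1-x_1-x_2,x_1)\bigr).$$ Let $\mathbb P^{\perp,\mathrm{refl}}_{p,p-1}(\widehat T)$ be the span of the polynomials $b^{\mathrm{refl}}_{p,k}(x_2,1-x_1-x_2)$ and $b^{\mathrm{refl}}_{p,k}(1-x_1-x_2,x_1)$,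 $0\le k\le d_{\mathrm{refl}}(p)-1$. For a triangle $T$, let $\mathbb P^{\perp,\mathrm{refl}}_{p,p-1}(T)=\{u\circ\chi^{-1}: u\in \mathbb P^{\perp,\mathrm{refl}}_{p,p-1}(\widehat T)\}$, where $\chi:\widehat T\to T$ is any affine bijection (the space does not depend on the choice). Let $K$ be the tetrahedron with vertices $A_0,A_1,A_2,A_3$, four non-coplanar points of $\mathbb R^3$, and let $T_i$ be its closed facet opposite to $A_i$. *Surface functions.* $Q^{(i)}_k:\partial K\to\mathbb R$ denotes a function which on each facet $T\ni A_i$ equals $b^{\mathrm{refl}}_{p,k}\circ\chi^{-1}$, where $\chi:\widehat T\to T$ is an affine bijection with $\chi(0)=A_i$, and which on $T_i$ is a totally symmetric polynomial of degree at most $p$ (invariant under all affine permutations of the vertices of $T_i$) agreeing with $b^{\mathrm{refl}}_{p,k}(t,1-t)$, $0\le t\le1$, on each edge of $T_i$. *Facet-oriented functions.* $B^{T_i}_{p,k}$ denotes the restriction to $K$ of the facet-oriented non-conforming basis function of the facet $T_i$, that is, the polynomial of total degree at most $p$ on $K$ with the following values at the nodal points $N=\sum_j \frac{\alpha_j}{p}A_j$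 $(\alpha\in\mathbb N_0^4,\ \sum_j\alpha_j=p)$: $B^{T_i}_{p,k}(N)=b^{\mathrm{refl}}_{p,k}(\chi^{-1}(N))$ if $N$ lies in a facet $T\ne T_i$, where $\chi:\widehat T\to T$ is an affine bijection with $\chi(0)=A_i$, and $B^{T_i}_{p,k}(N)=0$ at all other nodal points. **Theorem.** (a) For all $0\le i\le 3$ and $0\le k\le d_{\mathrm{refl}}(p)-1$ a function $Q_k^{(i)}$ as above exists, and for every choice of such functions the family $Q^{(i)}_k$, $0\le k\le d_{\mathrm{refl}}(p)-1$, $i=0,1,2,3$, is linearly independent. (b) The polynomials $B^{T_i}_{p,k}$ are well defined (exist and are unique), and for every facet $T$ of $K$ $$\operatorname{span}\bigl\{B^{T'}_{p,k}\big|_T:\ T'\ne T \text{ a facet of } K,\ 0\le k\le d_{\mathrm{refl}}(p)-1\bigr\}=\mathbb P^{\perp,\mathrm{refl}}_{p,p-1}(T).$$ -/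

import Mathlib

namespace ReflSurface

open scoped Nat

noncomputable section

/-- The Jacobi polynomial `P_n^{(α,β)}`, as the terminating hypergeometric sum
`(α+1)_n / n! * ₂F₁(-n, n+α+β+1; α+1; (1-x)/2)`. -/
def jacobi (n : ℕ) (α β : ℝ) : Polynomial ℝ :=
  Polynomial.C ((ascPochhammer ℝ n).eval (α + 1) / (n ! : ℝ)) *
    ∑ k ∈ Finset.range (n + 1),
      Polynomial.C (((ascPochhammer ℝ k).eval (-(n : ℝ)) *
          (ascPochhammer ℝ k).eval ((n : ℝ) + α + β + 1)) /
          ((ascPochhammer ℝ k).eval (α + 1) * (k ! : ℝ))) *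
        (Polynomial.C (1 / 2) * (1 - Polynomial.X)) ^ k

/-- The Legendre polynomial `P_k^{(0,0)}`. -/
def legendre (k : ℕ) : Polynomial ℝ := jacobi k 0 0

/-- The orthogonal polynomials on the reference triangle,
`b_{n,k}(x₁,x₂) = (x₁+x₂)^k P_{n-k}^{(0,2k+1)}(2(x₁+x₂)-1) P_k^{(0,0)}((x₁-x₂)/(x₁+x₂))` for `k ≤ n`.
The factor `(x₁+x₂)^k P_k((x₁-x₂)/(x₁+x₂))` is expanded so that `b_{n,k}` is a genuine polynomial;
`eval_bPoly` recovers the displayed formula. -/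
def bPoly (n k : ℕ) : MvPolynomial (Fin 2) ℝ :=
  (∑ j ∈ Finset.range (k + 1),
      MvPolynomial.C ((legendre k).coeff j) *
        (MvPolynomial.X 0 - MvPolynomial.X 1) ^ j *
        (MvPolynomial.X 0 + MvPolynomial.X 1) ^ (k - j)) *
    Polynomial.aeval (2 * (MvPolynomial.X 0 + MvPolynomial.X 1) - 1 : MvPolynomial (Fin 2) ℝ)
      (jacobi (n - k) 0 (2 * (k : ℝ) + 1))

theorem natDegree_jacobi_le (n : ℕ) (α β : ℝ) : (jacobi n α β).natDegree ≤ n := by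
  unfold jacobi
  refine (Polynomial.natDegree_C_mul_le _ _).trans ?_
  refine Polynomial.natDegree_sum_le_of_forall_le _ _ fun k hk => ?_
  refine (Polynomial.natDegree_C_mul_le _ _).trans ?_
  refine Polynomial.natDegree_pow_le.trans ?_
  have h1 : (Polynomial.C (1 / 2 : ℝ) * (1 - Polynomial.X)).natDegree ≤ 1 := by
    refine (Polynomial.natDegree_C_mul_le _ _).trans ?_
    refine (Polynomial.natDegree_sub_le _ _).trans ?_
    simp
  have h2 : k ≤ n := Nat.lt_succ_iff.mp (Finset.mem_range.mp hk)
  calc k * _ ≤ k * 1 := Nat.mul_le_mul_left _ h1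
    _ ≤ n := by omega

theorem eval_bPoly (n k : ℕ) (x : Fin 2 → ℝ) (hx : x 0 + x 1 ≠ 0) :
    MvPolynomial.eval x (bPoly n k) =
      (x 0 + x 1) ^ k *
        (jacobi (n - k) 0 (2 * (k : ℝ) + 1)).eval (2 * (x 0 + x 1) - 1) *
        (legendre k).eval ((x 0 - x 1) / (x 0 + x 1)) := by
  have h1 : MvPolynomial.eval x (Polynomial.aeval
      (2 * (MvPolynomial.X 0 + MvPolynomial.X 1) - 1 : MvPolynomial (Fin 2) ℝ)
      (jacobi (n - k) 0 (2 * (k : ℝ) + 1))) =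
      (jacobi (n - k) 0 (2 * (k : ℝ) + 1)).eval (2 * (x 0 + x 1) - 1) := by
    rw [← MvPolynomial.coe_aeval_eq_eval, RingHom.coe_coe, ← Polynomial.aeval_algHom_apply,
      Polynomial.coe_aeval_eq_eval]
    simp
  have h2 : (legendre k).natDegree < k + 1 := Nat.lt_succ_of_le (natDegree_jacobi_le k 0 0)
  rw [bPoly, map_mul, h1, Polynomial.eval_eq_sum_range' h2, map_sum, Finset.sum_mul,
    Finset.mul_sum]
  refine Finset.sum_congr rfl fun j hj => ?_
  have h3 : j ≤ k := Nat.lt_succ_iff.mp (Finset.mem_range.mp hj)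
  have h4 : (x 0 + x 1) ^ k = (x 0 + x 1) ^ (k - j) * (x 0 + x 1) ^ j := by
    rw [← pow_add]; congr 1; omega
  simp only [map_mul, map_pow, map_sub, map_add, MvPolynomial.eval_C, MvPolynomial.eval_X, div_pow]
  rw [h4]
  field_simp

/-- The rotation `f ↦ f(x₂, 1-x₁-x₂)` of polynomials on the reference triangle (written `RM`). -/
def rotRM : MvPolynomial (Fin 2) ℝ →ₐ[ℝ] MvPolynomial (Fin 2) ℝ :=
  MvPolynomial.aeval ![MvPolynomial.X 1, 1 - MvPolynomial.X 0 - MvPolynomial.X 1]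

/-- The rotation `f ↦ f(1-x₁-x₂, x₁)` of polynomials on the reference triangle (written `MR`). -/
def rotMR : MvPolynomial (Fin 2) ℝ →ₐ[ℝ] MvPolynomial (Fin 2) ℝ :=
  MvPolynomial.aeval ![1 - MvPolynomial.X 0 - MvPolynomial.X 1, MvPolynomial.X 0]

/-- `d_refl(p) = ⌊(p+2)/3⌋`. -/
def dRefl (p : ℕ) : ℕ := (p + 2) / 3

/-- `b^refl_{p,k} = (1/3)(2 b_{p,2k}(x₁,x₂) - b_{p,2k}(x₂,1-x₁-x₂) - b_{p,2k}(1-x₁-x₂,x₁))`. -/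
def bRefl (p k : ℕ) : MvPolynomial (Fin 2) ℝ :=
  MvPolynomial.C (1 / 3) *
    (2 * bPoly p (2 * k) - rotRM (bPoly p (2 * k)) - rotMR (bPoly p (2 * k)))

/-- The reflection-type space on the reference triangle,
spanned by `RM b^refl_{p,k}` and `MR b^refl_{p,k}`, `0 ≤ k ≤ d_refl(p) - 1`. -/
def reflSpaceRef (p : ℕ) : Submodule ℝ (MvPolynomial (Fin 2) ℝ) :=
  Submodule.span ℝ
    (Set.range (fun k : Fin (dRefl p) => rotRM (bRefl p k)) ∪
      Set.range (fun k : Fin (dRefl p) => rotMR (bRefl p k)))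

/-- The closed reference triangle with vertices `(0,0)`, `(1,0)`, `(0,1)`. -/
def refTriangle : Set (Fin 2 → ℝ) := {x | 0 ≤ x 0 ∧ 0 ≤ x 1 ∧ x 0 + x 1 ≤ 1}

/-- The vertices of the reference triangle. -/
def refVertex : Fin 3 → Fin 2 → ℝ := ![![0, 0], ![1, 0], ![0, 1]]

/-- The affine map `χ` taking `(0,0)`, `(1,0)`, `(0,1)` to `P`, `Q`, `R`. -/
def triMap {d : ℕ} (P Q R : Fin d → ℝ) (x : Fin 2 → ℝ) : Fin d → ℝ :=
  P + x 0 • (Q - P) + x 1 • (R - P)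

/-- Invariance on the reference triangle under all affine maps that permute its vertices. -/
def IsTotallySymmetric (w : MvPolynomial (Fin 2) ℝ) : Prop :=
  ∀ π : Equiv.Perm (Fin 3), ∀ x ∈ refTriangle,
    MvPolynomial.eval (triMap (refVertex (π 0)) (refVertex (π 1)) (refVertex (π 2)) x) w =
      MvPolynomial.eval x w

/-- The closed facet opposite to the vertex `A i` of the tetrahedron with vertices `A`. -/
def facet (A : Fin 4 → Fin 3 → ℝ) (i : Fin 4) : Set (Fin 3 → ℝ) :=
  convexHull ℝ (A '' {j | j ≠ i})

/-- The surface of the tetrahedron with vertices `A`. -/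
def surface (A : Fin 4 → Fin 3 → ℝ) : Set (Fin 3 → ℝ) := ⋃ i, facet A i

/-- `Q` is a surface function `Q_k^{(i)}` centred at the vertex `A i`: on the three facets through
`A i` it is `b^refl_{p,k}` in affine coordinates with origin `A i`, and on the opposite facet it is
a totally symmetric polynomial of degree at most `p` with the values of `b^refl_{p,k}(t, 1-t)` on
the edges. -/
def IsReflSurfaceFun (p k : ℕ) (A : Fin 4 → Fin 3 → ℝ) (i : Fin 4) (Q : surface A → ℝ) : Prop :=
  (∀ a b : Fin 4, a ≠ i → b ≠ i → a ≠ b → ∀ x ∈ refTriangle, ∀ y : surface A,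
      (y : Fin 3 → ℝ) = triMap (A i) (A a) (A b) x → Q y = MvPolynomial.eval x (bRefl p k)) ∧
  ∃ w : MvPolynomial (Fin 2) ℝ, w.totalDegree ≤ p ∧ IsTotallySymmetric w ∧
    (∀ t ∈ Set.Icc (0 : ℝ) 1,
      MvPolynomial.eval ![t, 1 - t] w = MvPolynomial.eval ![t, 1 - t] (bRefl p k)) ∧
    ∀ a b c : Fin 4, a ≠ i → b ≠ i → c ≠ i → a ≠ b → a ≠ c → b ≠ c →
      ∀ x ∈ refTriangle, ∀ y : surface A,
        (y : Fin 3 → ℝ) = triMap (A a) (A b) (A c) x → Q y = MvPolynomial.eval x w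

/-- The equispaced nodal points of order `p` of the tetrahedron with vertices `A`. -/
def nodes (p : ℕ) (A : Fin 4 → Fin 3 → ℝ) : Set (Fin 3 → ℝ) :=
  {N | ∃ α : Fin 4 → ℕ, ∑ j, α j = p ∧ N = ∑ j, ((α j : ℝ) / (p : ℝ)) • A j}

/-- `B` is the restriction to the tetrahedron of the facet-oriented non-conforming function
`B_{p,k}^{T,nc}` of the facet `T` opposite to `A i`: the polynomial of degree at most `p` whose
values at the nodal points are `b^refl_{p,k}`, lifted with the origin mapped to `A i`, on the three
other facets, and `0` at all remaining nodal points. -/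
def IsFacetOriented (p k : ℕ) (A : Fin 4 → Fin 3 → ℝ) (i : Fin 4)
    (B : MvPolynomial (Fin 3) ℝ) : Prop :=
  B.totalDegree ≤ p ∧
  ∀ N ∈ nodes p A,
    (∀ a b : Fin 4, a ≠ i → b ≠ i → a ≠ b → ∀ x ∈ refTriangle,
      N = triMap (A i) (A a) (A b) x →
        MvPolynomial.eval N B = MvPolynomial.eval x (bRefl p k)) ∧
    ((∀ j : Fin 4, j ≠ i → N ∉ facet A j) → MvPolynomial.eval N B = 0)

/-- The reflection-type space on a triangle `T` with vertices `P`, `Q`, `R`: all functions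
`u ∘ χ⁻¹` on `T`, where `u` is in the reflection-type space on the reference triangle and `χ` is the
affine bijection of the reference triangle onto `T` with `χ(0,0) = P`, `χ(1,0) = Q`,
`χ(0,1) = R`. -/
def reflSpace (p : ℕ) (T : Set (Fin 3 → ℝ)) (P Q R : Fin 3 → ℝ) : Set (T → ℝ) :=
  {f | ∃ u ∈ reflSpaceRef p, ∀ x ∈ refTriangle, ∀ y : T,
    (y : Fin 3 → ℝ) = triMap P Q R x → f y = MvPolynomial.eval x u}

end

end ReflSurface

open ReflSurface

/-! Write d for `dRefl p`, and RM, MR for the two rotations of the reference triangle.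

Independence in (a): given a vanishing combination of the surface functions, let β_i be the
combination of the b^refl_{p,k} with the coefficients belonging to A_i, and W_i the same combination
of the symmetric polynomials on T_i. On a facet T_j with vertices A_a, A_b, A_e the relation reads
β_a + RM β_b + MR β_e + W_j = 0. The rotates of each b^refl add up to zero (`bRefl_add_rot`) and W_j
is rotation invariant, so adding the three rotated relations leaves 3 W_j = 0. Hence β_i vanishes on
the edge x₁ + x₂ = 1, where it agrees with W_i. Moreover β_i is orthogonal to all polynomials of
degree below p (`triIntegral_bRefl_mul`). Writing β_i = (1 - x₁ - x₂) q with deg q < p and testing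
against q forces q = 0 (`eq_zero_of_orthogonal_of_edge`).

It remains that the b^refl_{p,k} are independent (`linearIndependent_bRefl`). A relation among them
yields a rotation-invariant u in the span of the b_{p,2k}. Its leading form along (t, 1 - t) has
degree at most 2(d - 1) and is divisible by t^m (1 - t)^m with m = p - 2(d - 1). Since 3(d - 1) < p,
it is zero, and the Legendre polynomials separate the coefficients.

Existence in (a): the edge values of b^refl are symmetric, hence of the form h(t(1 - t))
(`exists_edge_polynomial`). Composing h with the second elementary symmetric function of the
barycentric coordinates gives the required polynomial on T_i.

Part (b): existence and uniqueness are interpolation at the principal lattice of a simplex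
(`exists_interpolant`, `eq_zero_of_eval_lattice`). Unisolvence on each face makes the restriction to
a facet equal to b^refl, RM b^refl or MR b^refl, according to the vertex, and b^refl = -RM b^refl -
MR b^refl gives the span. -/

namespace ReflSurface

/-! ### Jacobi polynomials: explicit coefficients, orthogonality, parity. -/

section

open Polynomial Finset
open scoped Nat

theorem integral_pow_mul_one_sub_pow (a b : ℕ) :
    ∫ x in (0 : ℝ)..1, x ^ a * (1 - x) ^ b = (a ! * b ! : ℝ) / (a + b + 1)! := by
  induction b generalizing a with
  | zero =>
    simp only [pow_zero, mul_one, integral_pow, add_zero]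
    rw [Nat.factorial_succ]
    have := Nat.factorial_ne_zero a
    push_cast
    field_simp
    simp
  | succ b ih =>
    -- Integration by parts: this function vanishes at both endpoints, which lowers b by one and
    -- raises a by one.
    have hd : ∀ x : ℝ, HasDerivAt (fun x : ℝ => x ^ (a + 1) * (1 - x) ^ (b + 1))
        ((a + 1) * (x ^ a * (1 - x) ^ (b + 1)) - (b + 1) * (x ^ (a + 1) * (1 - x) ^ b)) x := by
      intro x
      have h1 := (hasDerivAt_pow (a + 1) x).mul (((hasDerivAt_id x).const_sub 1).pow (b + 1))
      convert! h1 using 1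
      simp
      ring
    have h := intervalIntegral.integral_eq_sub_of_hasDerivAt (a := 0) (b := 1)
      (fun x _ => hd x) (Continuous.intervalIntegrable (by fun_prop) _ _)
    rw [intervalIntegral.integral_sub (Continuous.intervalIntegrable (by fun_prop) _ _)
      (Continuous.intervalIntegrable (by fun_prop) _ _), intervalIntegral.integral_const_mul,
      intervalIntegral.integral_const_mul, ih (a + 1)] at h
    simp only [sub_self, ne_eq, Nat.add_eq_zero_iff, one_ne_zero, and_false, not_false_eq_true,
      zero_pow, mul_zero, zero_mul, sub_zero] at h
    have h0 : ((a : ℝ) + 1) ≠ 0 := by positivity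
    rw [sub_eq_zero] at h
    have hf := Nat.factorial_ne_zero (a + (b + 1) + 1)
    have e : a + 1 + b + 1 = a + (b + 1) + 1 := by ring
    rw [e] at h
    apply mul_left_cancel₀ h0
    rw [h, Nat.factorial_succ a, Nat.factorial_succ b]
    push_cast
    field_simp

theorem jacobi_zero_eq (n b : ℕ) :
    jacobi n 0 b = ∑ k ∈ range (n + 1),
      C ((-1 : ℝ) ^ k * n.choose k * (n + b + k).choose k) * (C (1 / 2) * (1 - X)) ^ k := by
  have h1 : ∀ k : ℕ, (ascPochhammer ℝ k).eval ((0 : ℝ) + 1) = k ! := fun k => by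
    rw [zero_add, ascPochhammer_eval_one]
  have hn : (n ! : ℝ) ≠ 0 := by positivity
  unfold jacobi
  rw [h1, div_self hn, C_1, one_mul]
  refine sum_congr rfl fun k _ => ?_
  congr 2
  have h2 : (ascPochhammer ℝ k).eval ((n : ℝ) + 0 + b + 1) = k ! * (n + b + k).choose k := by
    have := ascPochhammer_nat_eq_natCast_ascFactorial ℝ (n + b + 1) k
    push_cast at this
    rw [add_zero, this, Nat.ascFactorial_eq_factorial_mul_choose]
    push_cast
    rfl
  have h3 : (ascPochhammer ℝ k).eval (-(n : ℝ)) = (-1) ^ k * (k ! * n.choose k) := by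
    rw [ascPochhammer_eval_neg_eq_descPochhammer, descPochhammer_eval_eq_descFactorial,
      Nat.descFactorial_eq_factorial_mul_choose]
    push_cast
    rfl
  have hk : (k ! : ℝ) ≠ 0 := by positivity
  rw [h1, h2, h3]
  field_simp

/-- Up to sign this sum is the n-th forward difference at 0, which kills degrees below n. -/
theorem sum_neg_one_pow_choose_mul_eval {n : ℕ} {P : ℝ[X]} (hP : P.natDegree < n) :
    ∑ k ∈ range (n + 1), (-1 : ℝ) ^ k * n.choose k * P.eval (k : ℝ) = 0 := by
  have h := congrFun (Polynomial.fwdDiff_iter_eq_zero_of_degree_lt hP) 0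
  rw [fwdDiff_iter_eq_sum_shift] at h
  have h2 : ∑ k ∈ range (n + 1), (-1 : ℝ) ^ k * n.choose k * P.eval (k : ℝ) =
      (-1) ^ n * ∑ k ∈ range (n + 1), ((-1 : ℤ) ^ (n - k) * n.choose k) •
        P.eval (0 + k • (1 : ℝ)) := by
    rw [mul_sum]
    refine sum_congr rfl fun k hk => ?_
    have hk' : k ≤ n := Nat.lt_succ_iff.mp (mem_range.mp hk)
    have h3 : (-1 : ℝ) ^ n * (-1) ^ (n - k) = (-1) ^ k := by
      rw [← pow_add]
      have : n + (n - k) = k + 2 * (n - k) := by omega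
      rw [this, pow_add, pow_mul]
      simp
    simp only [zsmul_eq_mul, nsmul_eq_mul, mul_one, zero_add]
    push_cast
    rw [← h3]
    ring
  rw [h2, h]
  simp

theorem jacobi_eval_two_mul_sub_one (n b : ℕ) (s : ℝ) :
    (jacobi n 0 b).eval (2 * s - 1) = ∑ k ∈ range (n + 1),
      ((-1 : ℝ) ^ k * n.choose k * (n + b + k).choose k) * (1 - s) ^ k := by
  rw [jacobi_zero_eq, eval_finsetSum]
  refine sum_congr rfl fun k _ => ?_
  simp only [eval_mul, eval_C, eval_pow, eval_sub, eval_one, eval_X]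
  congr 2
  ring

/-- Expansion in powers of 1 - s turns the integral into an alternating binomial sum of Beta values,
hence into an n-th difference. -/
theorem integral_jacobi_mul_one_sub_pow {n b j : ℕ} (hj : j < n) :
    ∫ s in (0 : ℝ)..1, s ^ b * (jacobi n 0 b).eval (2 * s - 1) * (1 - s) ^ j = 0 := by
  have e : ∀ s : ℝ, s ^ b * (jacobi n 0 b).eval (2 * s - 1) * (1 - s) ^ j =
      ∑ k ∈ range (n + 1), ((-1 : ℝ) ^ k * n.choose k * (n + b + k).choose k) *
        (s ^ b * (1 - s) ^ (k + j)) := by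
    intro s
    rw [jacobi_eval_two_mul_sub_one, mul_sum, sum_mul]
    refine sum_congr rfl fun k _ => ?_
    rw [pow_add]
    ring
  simp_rw [e]
  rw [intervalIntegral.integral_finsetSum
    fun k _ => Continuous.intervalIntegrable (by fun_prop) _ _]
  simp_rw [intervalIntegral.integral_const_mul, integral_pow_mul_one_sub_pow]
  -- Times the Beta value, the binomial (n+b+k choose k) equals b!/(n+b)! · (k+j)!/k! ·
  -- (n+b+k)!/(b+k+j+1)!. Both factorial quotients are Pochhammer polynomials in k, of degrees j and
  -- n-j-1, so the total degree is n-1.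
  let P : ℝ[X] := C ((b ! : ℝ) / (n + b)!) * ((ascPochhammer ℝ j).comp (X + C 1) *
    (ascPochhammer ℝ (n - j - 1)).comp (X + C ((b + j + 2 : ℕ) : ℝ)))
  have hP : P.natDegree < n := by
    refine lt_of_le_of_lt (natDegree_C_mul_le _ _) ?_
    refine lt_of_le_of_lt natDegree_mul_le ?_
    rw [natDegree_comp, natDegree_comp, natDegree_X_add_C, natDegree_X_add_C,
      ascPochhammer_natDegree, ascPochhammer_natDegree]
    omega
  rw [← sum_neg_one_pow_choose_mul_eval hP]
  refine sum_congr rfl fun k _ => ?_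
  rw [mul_assoc ((-1 : ℝ) ^ k * _)]
  congr 1
  have h1 : (ascPochhammer ℝ j).eval ((k : ℝ) + 1) = (k + j)! / k ! := by
    have := ascPochhammer_nat_eq_natCast_ascFactorial ℝ (k + 1) j
    push_cast at this
    rw [this, eq_div_iff (by positivity), mul_comm]
    exact_mod_cast Nat.factorial_mul_ascFactorial k j
  have h2 : (ascPochhammer ℝ (n - j - 1)).eval ((k : ℝ) + ((b + j + 2 : ℕ) : ℝ)) =
      (n + b + k)! / (b + (k + j) + 1)! := by
    have := ascPochhammer_nat_eq_natCast_ascFactorial ℝ (b + (k + j) + 1 + 1) (n - j - 1)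
    have e2 : (k : ℝ) + ((b + j + 2 : ℕ) : ℝ) = ((b + (k + j) + 1 + 1 : ℕ) : ℝ) := by
      push_cast; ring
    rw [e2, this, eq_div_iff (by positivity), mul_comm]
    have h3 := Nat.factorial_mul_ascFactorial (b + (k + j) + 1) (n - j - 1)
    have h4 : b + (k + j) + 1 + (n - j - 1) = n + b + k := by omega
    rw [h4] at h3
    exact_mod_cast h3
  have h3 : ((n + b + k).choose k : ℝ) = (n + b + k)! / (k ! * (n + b)!) := by
    rw [eq_div_iff (by positivity)]
    have := Nat.choose_mul_factorial_mul_factorial (Nat.le_add_left k (n + b))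
    rw [Nat.add_sub_cancel] at this
    rw [← mul_assoc]
    exact_mod_cast this
  simp only [P, eval_mul, eval_C, eval_comp, eval_add, eval_X]
  rw [h1, h2, h3]
  field_simp

/-- Orthogonality of the Jacobi polynomials `P_n^{(0,b)}`, transported to `[0, 1]`. -/
theorem integral_jacobi_mul_eval {n b : ℕ} {q : ℝ[X]} (hq : q.natDegree < n) :
    ∫ s in (0 : ℝ)..1, s ^ b * (jacobi n 0 b).eval (2 * s - 1) * q.eval s = 0 := by
  have e : ∀ s : ℝ, q.eval s =
      ∑ j ∈ range n, (q.comp (1 - X)).coeff j * (1 - s) ^ j := by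
    intro s
    have h1 : (q.comp (1 - X)).natDegree < n := by
      refine lt_of_le_of_lt (natDegree_comp_le) ?_
      have : ((1 : ℝ[X]) - X).natDegree ≤ 1 := (natDegree_sub_le _ _).trans (by simp)
      nlinarith
    rw [← eval_eq_sum_range' h1, eval_comp]
    simp
  simp_rw [e, mul_sum]
  rw [intervalIntegral.integral_finsetSum
    fun k _ => Continuous.intervalIntegrable (by fun_prop) _ _]
  refine sum_eq_zero fun j hj => ?_
  have e2 : ∀ s : ℝ, s ^ b * (jacobi n 0 b).eval (2 * s - 1) *
      ((q.comp (1 - X)).coeff j * (1 - s) ^ j) = (q.comp (1 - X)).coeff j *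
      (s ^ b * (jacobi n 0 b).eval (2 * s - 1) * (1 - s) ^ j) := fun s => by ring
  simp_rw [e2]
  rw [intervalIntegral.integral_const_mul, integral_jacobi_mul_one_sub_pow (mem_range.mp hj),
    mul_zero]

theorem integral_legendre_mul_eval {n : ℕ} {q : ℝ[X]} (hq : q.natDegree < n) :
    ∫ s in (0 : ℝ)..1, (legendre n).eval (2 * s - 1) * q.eval s = 0 := by
  have := integral_jacobi_mul_eval (b := 0) hq
  simpa [legendre] using this

theorem coeff_jacobi_self_ne_zero (n b : ℕ) : (jacobi n 0 b).coeff n ≠ 0 := by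
  have hlin : (C (1 / 2 : ℝ) * (1 - X)).natDegree ≤ 1 :=
    (natDegree_C_mul_le _ _).trans ((natDegree_sub_le _ _).trans (by simp))
  rw [jacobi_zero_eq, finsetSum_coeff, sum_range_succ, sum_eq_zero, zero_add, coeff_C_mul]
  · have h1 : ((C (1 / 2 : ℝ) * (1 - X)) ^ n).coeff n = (-(1 / 2)) ^ n := by
      have := coeff_pow_of_natDegree_le (n := 1) hlin (m := n)
      rw [mul_one] at this
      rw [this]
      simp [coeff_one]
    rw [h1]
    have h2 : ((n + b + n).choose n : ℝ) ≠ 0 := by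
      exact_mod_cast (Nat.choose_pos (Nat.le_add_left _ _)).ne'
    simp [h2]
  · intro k hk
    rw [coeff_C_mul, coeff_eq_zero_of_natDegree_lt, mul_zero]
    refine lt_of_le_of_lt natDegree_pow_le ?_
    have := mem_range.mp hk
    nlinarith

theorem natDegree_jacobi (n b : ℕ) : (jacobi n 0 b).natDegree = n :=
  le_antisymm (natDegree_jacobi_le n 0 b) (le_natDegree_of_ne_zero (coeff_jacobi_self_ne_zero n b))

theorem legendre_eq_jacobi (n : ℕ) : legendre n = jacobi n 0 (0 : ℕ) := by simp [legendre]

/-- Evenness comes from the reflection symmetry of Mathlib's `shiftedLegendre`. It is what makes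
b_{p,2k} symmetric in x₁ and x₂. -/
theorem legendre_comp_neg_X (k : ℕ) : (legendre (2 * k)).comp (-X) = legendre (2 * k) := by
  have h : ∀ x : ℝ, (legendre (2 * k)).eval (2 * x - 1) =
      aeval (1 - x) (shiftedLegendre (2 * k)) := by
    intro x
    rw [legendre_eq_jacobi, jacobi_eval_two_mul_sub_one, shiftedLegendre, map_sum]
    refine sum_congr rfl fun j _ => ?_
    simp only [add_zero, map_mul, map_pow, aeval_C, aeval_X]
    rw [Nat.choose_symm_add]
    simp
  refine Polynomial.funext fun x => ?_
  rw [eval_comp, eval_neg, eval_X]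
  have h1 := h ((1 - x) / 2)
  have h2 := h ((1 + x) / 2)
  rw [shiftedLegendre_eval_symm] at h1
  rw [show 2 * ((1 - x) / 2) - 1 = -x by ring, show 1 - (1 - (1 - x) / 2) = (1 - x) / 2 by ring]
    at h1
  rw [show 2 * ((1 + x) / 2) - 1 = x by ring, show 1 - (1 + x) / 2 = (1 - x) / 2 by ring] at h2
  rw [h1, h2]
  simp

theorem coeff_legendre_of_odd {k j : ℕ} (hj : Odd j) : (legendre (2 * k)).coeff j = 0 := by
  have h := congrArg (fun q => coeff q j) (legendre_comp_neg_X k)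
  rw [show (-X : ℝ[X]) = C (-1) * X by simp] at h
  simp only [comp_C_mul_X_coeff, hj.neg_one_pow] at h
  linarith

end

/-! ### Polynomials on the reference triangle: degrees, swap symmetry, rotations. -/

section

open MvPolynomial Finset
open scoped Nat

theorem totalDegree_polynomial_aeval_le {σ : Type*} (q : Polynomial ℝ) (r : MvPolynomial σ ℝ) :
    (Polynomial.aeval r q).totalDegree ≤ q.natDegree * r.totalDegree := by
  rw [Polynomial.aeval_eq_sum_range]
  refine totalDegree_finsetSum_le fun i hi => ?_
  refine (totalDegree_smul_le _ _).trans ((totalDegree_pow _ _).trans ?_)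
  exact Nat.mul_le_mul_right _ (Nat.lt_succ_iff.mp (mem_range.mp hi))

theorem totalDegree_aeval_le {σ τ : Type*} {f : τ → MvPolynomial σ ℝ}
    (hf : ∀ i, (f i).totalDegree ≤ 1) (q : MvPolynomial τ ℝ) :
    (aeval f q).totalDegree ≤ q.totalDegree := by
  rw [aeval_def, eval₂_eq]
  refine totalDegree_finsetSum_le fun s hs => ?_
  refine (totalDegree_mul _ _).trans ?_
  rw [MvPolynomial.algebraMap_eq, totalDegree_C, zero_add]
  refine (totalDegree_finsetProd _ _).trans ((sum_le_sum fun i _ => ?_).trans (le_totalDegree hs))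
  exact (totalDegree_pow _ _).trans ((Nat.mul_le_mul_left _ (hf i)).trans (mul_one _).le)

theorem totalDegree_add_le_of_le {σ : Type*} {p q : MvPolynomial σ ℝ} {n : ℕ}
    (hp : p.totalDegree ≤ n) (hq : q.totalDegree ≤ n) : (p + q).totalDegree ≤ n :=
  (totalDegree_add _ _).trans (max_le hp hq)

theorem totalDegree_sub_le_of_le {σ : Type*} {p q : MvPolynomial σ ℝ} {n : ℕ}
    (hp : p.totalDegree ≤ n) (hq : q.totalDegree ≤ n) : (p - q).totalDegree ≤ n :=
  (totalDegree_sub _ _).trans (max_le hp hq)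

theorem totalDegree_X_le (σ : Type*) (i : σ) : (X i : MvPolynomial σ ℝ).totalDegree ≤ 1 :=
  (totalDegree_X i).le

theorem totalDegree_bPoly_le {n k : ℕ} (hk : k ≤ n) : (bPoly n k).totalDegree ≤ n := by
  have h0 : (X 0 : MvPolynomial (Fin 2) ℝ).totalDegree ≤ 1 := totalDegree_X_le _ _
  have h1 : (X 1 : MvPolynomial (Fin 2) ℝ).totalDegree ≤ 1 := totalDegree_X_le _ _
  have hs := totalDegree_add_le_of_le h0 h1
  have hd := totalDegree_sub_le_of_le h0 h1
  refine (totalDegree_mul _ _).trans ?_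
  have e1 : (2 * (X 0 + X 1) - 1 : MvPolynomial (Fin 2) ℝ).totalDegree ≤ 1 := by
    refine totalDegree_sub_le_of_le ((totalDegree_mul _ _).trans ?_) (by simp)
    rw [show (2 : MvPolynomial (Fin 2) ℝ) = C 2 from (map_ofNat C 2).symm, totalDegree_C, zero_add]
    exact hs
  have e2 := (totalDegree_polynomial_aeval_le (jacobi (n - k) 0 (2 * (k : ℝ) + 1))
    (2 * (X 0 + X 1) - 1 : MvPolynomial (Fin 2) ℝ)).trans
      (Nat.mul_le_mul (natDegree_jacobi_le _ _ _) e1)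
  have e3 : (∑ j ∈ range (k + 1), C ((legendre k).coeff j) * (X 0 - X 1) ^ j *
      (X 0 + X 1) ^ (k - j) : MvPolynomial (Fin 2) ℝ).totalDegree ≤ k := by
    refine totalDegree_finsetSum_le fun j hj => ?_
    have hj' := Nat.lt_succ_iff.mp (mem_range.mp hj)
    refine (totalDegree_mul _ _).trans ?_
    have a1 := (totalDegree_pow (X 0 + X 1 : MvPolynomial (Fin 2) ℝ) (k - j)).trans
      (Nat.mul_le_mul_left _ hs)
    have a2 := (totalDegree_pow (X 0 - X 1 : MvPolynomial (Fin 2) ℝ) j).trans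
      (Nat.mul_le_mul_left _ hd)
    have a3 := totalDegree_mul (C ((legendre k).coeff j)) ((X 0 - X 1 : MvPolynomial (Fin 2) ℝ) ^ j)
    rw [totalDegree_C] at a3
    omega
  omega

/-- Only even powers of x₁ - x₂ occur, because the Legendre index is even. -/
theorem eval_bPoly_swap (n k : ℕ) (s t : ℝ) :
    eval ![s, t] (bPoly n (2 * k)) = eval ![t, s] (bPoly n (2 * k)) := by
  have h2 : ∀ (q : Polynomial ℝ) (x : Fin 2 → ℝ), eval x (Polynomial.aeval
      (2 * (X 0 + X 1) - 1 : MvPolynomial (Fin 2) ℝ) q) = q.eval (2 * (x 0 + x 1) - 1) := by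
    intro q x
    rw [← coe_aeval_eq_eval, RingHom.coe_coe, ← Polynomial.aeval_algHom_apply,
      Polynomial.coe_aeval_eq_eval]
    simp
  simp only [bPoly, map_mul, map_sum, h2]
  simp only [map_pow, map_sub, map_add, eval_C, eval_X, Matrix.cons_val_zero, Matrix.cons_val_one]
  rw [add_comm t s]
  congr 1
  refine sum_congr rfl fun j _ => ?_
  rcases Nat.even_or_odd j with hj | hj
  · rw [← hj.neg_pow (s - t), neg_sub]
  · rw [coeff_legendre_of_odd hj]
    simp

/-- In collapsed coordinates `x₁ = s t`, `x₂ = s (1 - t)` the polynomial `b_{n,k}` factorizes. -/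
theorem eval_bPoly_collapsed (n k : ℕ) (s t : ℝ) :
    eval ![s * t, s * (1 - t)] (bPoly n k) =
      s ^ k * (legendre k).eval (2 * t - 1) *
        (jacobi (n - k) 0 (2 * (k : ℝ) + 1)).eval (2 * s - 1) := by
  have h1 : eval ![s * t, s * (1 - t)] (Polynomial.aeval
      (2 * (X 0 + X 1) - 1 : MvPolynomial (Fin 2) ℝ) (jacobi (n - k) 0 (2 * (k : ℝ) + 1))) =
      (jacobi (n - k) 0 (2 * (k : ℝ) + 1)).eval (2 * s - 1) := by
    rw [← coe_aeval_eq_eval, RingHom.coe_coe, ← Polynomial.aeval_algHom_apply,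
      Polynomial.coe_aeval_eq_eval]
    congr 1
    simp
    ring
  have h2 : (legendre k).natDegree < k + 1 := Nat.lt_succ_of_le (natDegree_jacobi_le k 0 0)
  rw [bPoly, map_mul, h1, Polynomial.eval_eq_sum_range' h2, map_sum, mul_sum]
  congr 1
  refine sum_congr rfl fun j hj => ?_
  have h3 : j ≤ k := Nat.lt_succ_iff.mp (mem_range.mp hj)
  have h4 : s ^ k = s ^ (k - j) * s ^ j := by
    rw [← pow_add]; congr 1; omega
  simp only [map_mul, map_pow, map_sub, map_add, eval_C, eval_X, Matrix.cons_val_zero,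
    Matrix.cons_val_one]
  rw [h4, show s * t - s * (1 - t) = s * (2 * t - 1) by ring,
    show s * t + s * (1 - t) = s by ring, mul_pow]
  ring

theorem rotRM_rotRM (f : MvPolynomial (Fin 2) ℝ) : rotRM (rotRM f) = rotMR f := by
  have : rotRM.comp rotRM = rotMR := by
    ext i
    fin_cases i <;> simp [rotRM, rotMR]
  exact DFunLike.congr_fun this f

theorem rotRM_rotMR (f : MvPolynomial (Fin 2) ℝ) : rotRM (rotMR f) = f := by
  have : rotRM.comp rotMR = AlgHom.id ℝ _ := by
    ext i
    fin_cases i <;> simp [rotRM, rotMR]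
  exact DFunLike.congr_fun this f

theorem rotMR_rotRM (f : MvPolynomial (Fin 2) ℝ) : rotMR (rotRM f) = f := by
  rw [← rotRM_rotRM (rotRM f), rotRM_rotRM f, rotRM_rotMR]

theorem eval_rotRM (x : Fin 2 → ℝ) (f : MvPolynomial (Fin 2) ℝ) :
    eval x (rotRM f) = eval ![x 1, 1 - x 0 - x 1] f := by
  rw [← coe_aeval_eq_eval, ← coe_aeval_eq_eval, RingHom.coe_coe, RingHom.coe_coe, rotRM,
    ← AlgHom.comp_apply, comp_aeval]
  congr 2
  ext i
  fin_cases i <;> simp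

theorem eval_rotMR (x : Fin 2 → ℝ) (f : MvPolynomial (Fin 2) ℝ) :
    eval x (rotMR f) = eval ![1 - x 0 - x 1, x 0] f := by
  rw [← rotRM_rotRM, eval_rotRM, eval_rotRM]
  congr 2
  ext i
  fin_cases i <;> simp

theorem totalDegree_rotRM_le (f : MvPolynomial (Fin 2) ℝ) :
    (rotRM f).totalDegree ≤ f.totalDegree := by
  refine totalDegree_aeval_le (fun i => ?_) f
  fin_cases i
  · exact totalDegree_X_le _ _
  · exact totalDegree_sub_le_of_le (totalDegree_sub_le_of_le (by simp) (totalDegree_X_le _ _))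
      (totalDegree_X_le _ _)

theorem totalDegree_rotMR_le (f : MvPolynomial (Fin 2) ℝ) :
    (rotMR f).totalDegree ≤ f.totalDegree := by
  rw [← rotRM_rotRM]
  exact (totalDegree_rotRM_le _).trans (totalDegree_rotRM_le _)

theorem two_mul_le_of_lt_dRefl {p k : ℕ} (hk : k < dRefl p) : 2 * k ≤ p := by
  unfold dRefl at hk
  omega

theorem totalDegree_bRefl_le {p k : ℕ} (hk : k < dRefl p) : (bRefl p k).totalDegree ≤ p := by
  have h := totalDegree_bPoly_le (two_mul_le_of_lt_dRefl hk)
  refine (totalDegree_mul _ _).trans ?_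
  rw [totalDegree_C, zero_add]
  refine totalDegree_sub_le_of_le (totalDegree_sub_le_of_le ((totalDegree_mul _ _).trans ?_)
    ((totalDegree_rotRM_le _).trans h)) ((totalDegree_rotMR_le _).trans h)
  rw [show (2 : MvPolynomial (Fin 2) ℝ) = C 2 from (map_ofNat C 2).symm, totalDegree_C, zero_add]
  exact h

theorem bRefl_add_rot (p k : ℕ) : bRefl p k + rotRM (bRefl p k) + rotMR (bRefl p k) = 0 := by
  have hC : ∀ r : MvPolynomial (Fin 2) ℝ →ₐ[ℝ] MvPolynomial (Fin 2) ℝ, r (C (1 / 3)) = C (1 / 3) :=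
    fun r => r.commutes _
  have h2 : ∀ r : MvPolynomial (Fin 2) ℝ →ₐ[ℝ] MvPolynomial (Fin 2) ℝ, r 2 = 2 :=
    fun r => map_ofNat r 2
  rw [← rotRM_rotRM (bRefl p k)]
  simp only [bRefl, map_mul, map_sub, hC, h2, rotRM_rotRM, rotRM_rotMR]
  ring

theorem eval_bRefl_swap (p k : ℕ) (s t : ℝ) :
    eval ![s, t] (bRefl p k) = eval ![t, s] (bRefl p k) := by
  simp only [bRefl, map_mul, map_sub, eval_C, map_ofNat, eval_rotRM, eval_rotMR,
    Matrix.cons_val_zero, Matrix.cons_val_one]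
  rw [eval_bPoly_swap p k s t, eval_bPoly_swap p k t (1 - s - t),
    eval_bPoly_swap p k (1 - s - t) s, show 1 - t - s = 1 - s - t by ring]
  ring

/-! ### Integration over the triangle, orthogonality, and determination by edge values. -/

/-- The integral over the reference triangle, written in the collapsed coordinates
`x₁ = s t`, `x₂ = s (1 - t)`. -/
noncomputable def triIntegral (f : MvPolynomial (Fin 2) ℝ) : ℝ :=
  ∫ s in (0 : ℝ)..1, ∫ t in (0 : ℝ)..1, s * eval ![s * t, s * (1 - t)] f

theorem continuous_eval_collapsed (f : MvPolynomial (Fin 2) ℝ) :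
    Continuous fun q : ℝ × ℝ => q.1 * eval ![q.1 * q.2, q.1 * (1 - q.2)] f := by
  refine continuous_fst.mul ((continuous_eval f).comp (continuous_pi fun i => ?_))
  fin_cases i
  · exact continuous_fst.mul continuous_snd
  · exact continuous_fst.mul (continuous_const.sub continuous_snd)

theorem continuous_eval_collapsed_right (f : MvPolynomial (Fin 2) ℝ) (s : ℝ) :
    Continuous fun t : ℝ => s * eval ![s * t, s * (1 - t)] f :=
  (continuous_eval_collapsed f).comp (Continuous.prodMk_right s)

theorem continuous_integral_collapsed (f : MvPolynomial (Fin 2) ℝ) :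
    Continuous fun s : ℝ => ∫ t in (0 : ℝ)..1, s * eval ![s * t, s * (1 - t)] f :=
  intervalIntegral.continuous_parametric_intervalIntegral_of_continuous'
    (continuous_eval_collapsed f) 0 1

theorem triIntegral_add (f g : MvPolynomial (Fin 2) ℝ) :
    triIntegral (f + g) = triIntegral f + triIntegral g := by
  unfold triIntegral
  rw [← intervalIntegral.integral_add ((continuous_integral_collapsed f).intervalIntegrable _ _)
    ((continuous_integral_collapsed g).intervalIntegrable _ _)]
  congr 1
  ext s
  rw [← intervalIntegral.integral_add
    ((continuous_eval_collapsed_right f s).intervalIntegrable _ _)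
    ((continuous_eval_collapsed_right g s).intervalIntegrable _ _)]
  simp_rw [map_add, mul_add]

theorem triIntegral_smul (c : ℝ) (f : MvPolynomial (Fin 2) ℝ) :
    triIntegral (c • f) = c * triIntegral f := by
  unfold triIntegral
  simp_rw [smul_eval, mul_left_comm _ c, intervalIntegral.integral_const_mul]

/-- `triIntegral` as a linear functional. -/
noncomputable def triIntegralₗ : MvPolynomial (Fin 2) ℝ →ₗ[ℝ] ℝ where
  toFun := triIntegral
  map_add' := triIntegral_add
  map_smul' := triIntegral_smul

theorem triIntegral_mul_separated {f : MvPolynomial (Fin 2) ℝ} {u v : ℝ → ℝ}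
    (h : ∀ s t : ℝ, s * eval ![s * t, s * (1 - t)] f = u s * v t) :
    triIntegral f = (∫ s in (0 : ℝ)..1, u s) * ∫ t in (0 : ℝ)..1, v t := by
  unfold triIntegral
  simp_rw [h, intervalIntegral.integral_const_mul, intervalIntegral.integral_mul_const]

/-- Collapsed coordinates hide this invariance, so it is checked on monomials: before and after
rotation the integral is a product of Beta values equal to m₀! m₁! / (m₀ + m₁ + 2)!. -/
theorem triIntegral_rotRM (f : MvPolynomial (Fin 2) ℝ) : triIntegral (rotRM f) = triIntegral f := by
  suffices h : triIntegralₗ ∘ₗ rotRM.toLinearMap = triIntegralₗ from LinearMap.congr_fun h f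
  refine MvPolynomial.linearMap_ext fun m => LinearMap.ext_ring ?_
  change triIntegral (rotRM (monomial m 1)) = triIntegral (monomial m 1)
  have h1 : triIntegral (monomial m 1) = _ :=
    triIntegral_mul_separated (u := fun s => s ^ (m 0 + m 1 + 1) * (1 - s) ^ 0)
      (v := fun t => t ^ m 0 * (1 - t) ^ m 1) (fun s t => by
        rw [eval_monomial, Finsupp.prod_fintype _ _ (by simp)]
        simp [Fin.prod_univ_two, mul_pow]
        ring)
  have h2 : triIntegral (rotRM (monomial m 1)) = _ :=
    triIntegral_mul_separated (u := fun s => s ^ (m 0 + 1) * (1 - s) ^ m 1)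
      (v := fun t => t ^ 0 * (1 - t) ^ m 0) (fun s t => by
        rw [eval_rotRM, eval_monomial, Finsupp.prod_fintype _ _ (by simp)]
        simp [Fin.prod_univ_two, mul_pow]
        rw [show 1 - s * t - s * (1 - t) = 1 - s by ring]
        ring)
  rw [h1, h2, integral_pow_mul_one_sub_pow, integral_pow_mul_one_sub_pow,
    integral_pow_mul_one_sub_pow, integral_pow_mul_one_sub_pow]
  have e1 : (0 + m 0 + 1)! = (m 0 + 1) * (m 0)! := by rw [zero_add, Nat.factorial_succ]
  have e2 : (m 0 + m 1 + 1 + 0 + 1)! = (m 0 + m 1 + 2) * (m 0 + m 1 + 1)! := by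
    rw [add_zero, Nat.factorial_succ]
  have e3 : (m 0 + 1 + m 1 + 1)! = (m 0 + m 1 + 2) * (m 0 + m 1 + 1)! := by
    rw [show m 0 + 1 + m 1 + 1 = m 0 + m 1 + 1 + 1 by ring, Nat.factorial_succ]
  rw [e1, e2, e3, Nat.factorial_succ (m 0)]
  have := Nat.factorial_pos (m 0)
  have := Nat.factorial_pos (m 1)
  have := Nat.factorial_pos (m 0 + m 1 + 1)
  push_cast
  field_simp

theorem triIntegral_rotMR (f : MvPolynomial (Fin 2) ℝ) : triIntegral (rotMR f) = triIntegral f := by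
  rw [← rotRM_rotRM, triIntegral_rotRM, triIntegral_rotRM]

/-- `b_{n,k}` is orthogonal to all polynomials of smaller total degree. -/
theorem triIntegral_bPoly_mul {n k : ℕ} (hk : k ≤ n) {q : MvPolynomial (Fin 2) ℝ}
    (hq : q.totalDegree < n) : triIntegral (bPoly n k * q) = 0 := by
  rw [q.as_sum, mul_sum]
  change triIntegralₗ _ = 0
  rw [map_sum]
  refine sum_eq_zero fun m hm => ?_
  have hm' : m 0 + m 1 < n := by
    refine lt_of_le_of_lt ?_ hq
    have := le_totalDegree hm
    rwa [Finsupp.sum_fintype _ _ (by simp), Fin.sum_univ_two] at this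
  change triIntegral (bPoly n k * monomial m (coeff m q)) = 0
  rw [triIntegral_mul_separated
    (u := fun s => s ^ (m 0 + m 1 + k + 1) *
      (jacobi (n - k) 0 (2 * (k : ℝ) + 1)).eval (2 * s - 1))
    (v := fun t => (legendre k).eval (2 * t - 1) *
      (Polynomial.C (coeff m q) * (Polynomial.X ^ m 0 * (1 - Polynomial.X) ^ m 1)).eval t)]
  -- Below degree k the t-integral vanishes by Legendre orthogonality. Otherwise s^(2k+1) is split
  -- off as the Jacobi weight, leaving s^(m₀+m₁-k), of degree less than n-k, and the s-integral
  -- vanishes.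
  · rcases lt_or_ge (m 0 + m 1) k with h | h
    · rw [integral_legendre_mul_eval, mul_zero]
      refine lt_of_le_of_lt ((Polynomial.natDegree_C_mul_le _ _).trans
        Polynomial.natDegree_mul_le) ?_
      have h1 : (1 - Polynomial.X : Polynomial ℝ).natDegree ≤ 1 :=
        (Polynomial.natDegree_sub_le _ _).trans (by simp)
      have h2 := (Polynomial.natDegree_pow_le (p := (1 - Polynomial.X : Polynomial ℝ))
        (n := m 1)).trans (Nat.mul_le_mul_left _ h1)
      rw [Polynomial.natDegree_X_pow]
      omega
    · have e : ∀ s : ℝ, s ^ (m 0 + m 1 + k + 1) *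
          (jacobi (n - k) 0 (2 * (k : ℝ) + 1)).eval (2 * s - 1) =
          s ^ (2 * k + 1) * (jacobi (n - k) 0 ((2 * k + 1 : ℕ) : ℝ)).eval (2 * s - 1) *
            (Polynomial.X ^ (m 0 + m 1 - k)).eval s := by
        intro s
        rw [Polynomial.eval_pow, Polynomial.eval_X, mul_right_comm, ← pow_add]
        push_cast
        congr 2
        omega
      simp_rw [e]
      rw [integral_jacobi_mul_eval, zero_mul]
      rw [Polynomial.natDegree_X_pow]
      omega
  · intro s t
    rw [map_mul, eval_bPoly_collapsed, eval_monomial, Finsupp.prod_fintype _ _ (by simp)]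
    simp [Fin.prod_univ_two, mul_pow]
    ring

/-- Rotations preserve the integral and do not raise the degree, so orthogonality passes from
b_{p,2k} to its rotates by moving the rotation onto q. -/
theorem triIntegral_bRefl_mul {p k : ℕ} (hk : k < dRefl p) {q : MvPolynomial (Fin 2) ℝ}
    (hq : q.totalDegree < p) : triIntegral (bRefl p k * q) = 0 := by
  have hk2 := two_mul_le_of_lt_dRefl hk
  have h1 : triIntegral (rotRM (bPoly p (2 * k)) * q) = 0 := by
    rw [← rotRM_rotMR q, ← map_mul, triIntegral_rotRM]
    exact triIntegral_bPoly_mul hk2 ((totalDegree_rotMR_le q).trans_lt hq)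
  have h2 : triIntegral (rotMR (bPoly p (2 * k)) * q) = 0 := by
    rw [← rotMR_rotRM q, ← map_mul, triIntegral_rotMR]
    exact triIntegral_bPoly_mul hk2 ((totalDegree_rotRM_le q).trans_lt hq)
  have h0 := triIntegral_bPoly_mul hk2 hq
  have e : bRefl p k * q = (2 / 3 : ℝ) • (bPoly p (2 * k) * q) +
      ((-1 / 3 : ℝ) • (rotRM (bPoly p (2 * k)) * q) +
        (-1 / 3 : ℝ) • (rotMR (bPoly p (2 * k)) * q)) := by
    simp only [smul_eq_C_mul, bRefl]
    rw [show (2 / 3 : ℝ) = 1 / 3 * 2 by norm_num, show (-1 / 3 : ℝ) = -(1 / 3) by norm_num,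
      C_mul, C_neg, show (C 2 : MvPolynomial (Fin 2) ℝ) = 2 from map_ofNat C 2]
    ring
  rw [e, triIntegral_add, triIntegral_add, triIntegral_smul, triIntegral_smul, triIntegral_smul,
    h0, h1, h2]
  simp

/-- Polynomials agreeing on the reference triangle are equal. -/
theorem eq_of_eval_eq_on_refTriangle {f g : MvPolynomial (Fin 2) ℝ}
    (h : ∀ x ∈ refTriangle, eval x f = eval x g) : f = g := by
  refine funext_set (fun _ => Set.Icc (0 : ℝ) (1 / 2)) (fun _ => Set.Icc_infinite (by norm_num))
    fun x hx => h x ?_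
  have h0 := hx 0 trivial
  have h1 := hx 1 trivial
  exact ⟨h0.1, h1.1, by linarith [h0.2, h1.2]⟩

/-- The integral over the triangle is strictly positive for the weight `1 - x₁ - x₂`. -/
theorem eq_zero_of_triIntegral_mul_sq {q : MvPolynomial (Fin 2) ℝ}
    (h : triIntegral ((1 - X 0 - X 1) * q * q) = 0) : q = 0 := by
  set f := (1 - X 0 - X 1) * q * q with hf
  have ev : ∀ s t : ℝ, s * eval ![s * t, s * (1 - t)] f =
      s * (1 - s) * (eval ![s * t, s * (1 - t)] q) ^ 2 := by
    intro s t
    simp [hf]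
    ring
  have nn : ∀ s ∈ Set.Icc (0 : ℝ) 1, ∀ t : ℝ, 0 ≤ s * eval ![s * t, s * (1 - t)] f := by
    intro s hs t
    rw [ev]
    have := sub_nonneg.mpr hs.2
    have := hs.1
    positivity
  have hq : ∀ s ∈ Set.Ioo (0 : ℝ) 1, ∀ t ∈ Set.Ioo (0 : ℝ) 1,
      eval ![s * t, s * (1 - t)] q = 0 := by
    intro s hs t ht
    by_contra hne
    have h1 : 0 < ∫ t in (0 : ℝ)..1, s * eval ![s * t, s * (1 - t)] f := by
      refine intervalIntegral.integral_pos one_pos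
        (continuous_eval_collapsed_right f s).continuousOn
        (fun t _ => nn s ⟨hs.1.le, hs.2.le⟩ t) ⟨t, ⟨ht.1.le, ht.2.le⟩, ?_⟩
      rw [ev]
      have := sub_pos.mpr hs.2
      have := hs.1
      positivity
    have h2 : 0 < triIntegral f := by
      refine intervalIntegral.integral_pos one_pos (continuous_integral_collapsed f).continuousOn
        (fun s hs => ?_) ⟨s, ⟨hs.1.le, hs.2.le⟩, h1⟩
      exact intervalIntegral.integral_nonneg zero_le_one fun t _ => nn s ⟨hs.1.le, hs.2⟩ t
    exact h2.ne' h
  refine funext_set (fun _ => Set.Ioo (0 : ℝ) (1 / 2)) (fun _ => Set.Ioo_infinite (by norm_num))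
    fun x hx => ?_
  have h0 := hx 0 trivial
  have h1 := hx 1 trivial
  have hpos : 0 < x 0 + x 1 := add_pos h0.1 h1.1
  have := hq (x 0 + x 1) ⟨hpos, by linarith [h0.2, h1.2]⟩ (x 0 / (x 0 + x 1))
    ⟨div_pos h0.1 hpos, (div_lt_one hpos).mpr (by linarith [h1.1])⟩
  have e : ![(x 0 + x 1) * (x 0 / (x 0 + x 1)), (x 0 + x 1) * (1 - x 0 / (x 0 + x 1))] = x := by
    ext i
    fin_cases i
    · simp; field_simp
    · simp; field_simp; ring
  rw [e] at this
  simpa using this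

/-- Substituting 1 - x₁ for x₂ changes a polynomial by a multiple of 1 - x₁ - x₂, and the
substituted f is zero. -/
theorem dvd_of_eval_edge_eq_zero {f : MvPolynomial (Fin 2) ℝ}
    (h : ∀ t ∈ Set.Icc (0 : ℝ) 1, eval ![t, 1 - t] f = 0) : (1 - X 0 - X 1) ∣ f := by
  have h1 : ∀ g : MvPolynomial (Fin 2) ℝ, (1 - X 0 - X 1 : MvPolynomial (Fin 2) ℝ) ∣
      g - aeval ![X 0, 1 - X 0] g := by
    intro g
    induction g using MvPolynomial.induction_on with
    | C a => simp
    | add g1 g2 h1 h2 =>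
      rw [map_add, add_sub_add_comm]
      exact dvd_add h1 h2
    | mul_X g i hg =>
      rw [map_mul, aeval_X]
      have e : (1 - X 0 - X 1 : MvPolynomial (Fin 2) ℝ) ∣
          X i - (![X 0, 1 - X 0] : Fin 2 → MvPolynomial (Fin 2) ℝ) i := by
        fin_cases i
        · simp
        · refine ⟨-1, ?_⟩
          simp
      exact dvd_mul_sub_mul hg e
  have h2 : aeval (![X 0, 1 - X 0] : Fin 2 → MvPolynomial (Fin 2) ℝ) f = 0 := by
    refine eq_of_eval_eq_on_refTriangle fun x hx => ?_
    rw [map_zero, ← h (x 0) ⟨hx.1, by linarith [hx.2.1, hx.2.2]⟩, ← coe_aeval_eq_eval,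
      ← coe_aeval_eq_eval, RingHom.coe_coe, RingHom.coe_coe, ← AlgHom.comp_apply, comp_aeval]
    congr 2
    ext i
    fin_cases i <;> simp
  have h3 := h1 f
  rwa [h2, sub_zero] at h3

/-- A polynomial of degree at most `p` orthogonal to all polynomials of degree less than `p` is
determined by its values on the edge `x₁ + x₂ = 1`. -/
theorem eq_zero_of_orthogonal_of_edge {p : ℕ} {f : MvPolynomial (Fin 2) ℝ}
    (hdeg : f.totalDegree ≤ p)
    (horth : ∀ q : MvPolynomial (Fin 2) ℝ, q.totalDegree < p → triIntegral (f * q) = 0)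
    (h : ∀ t ∈ Set.Icc (0 : ℝ) 1, eval ![t, 1 - t] f = 0) : f = 0 := by
  obtain ⟨q, rfl⟩ := dvd_of_eval_edge_eq_zero h
  by_cases hq : q = 0
  · simp [hq]
  have hl : (1 - X 0 - X 1 : MvPolynomial (Fin 2) ℝ) ≠ 0 := fun h0 => by
    have := congrArg (eval 0) h0
    simp at this
  have hl1 : 1 ≤ (1 - X 0 - X 1 : MvPolynomial (Fin 2) ℝ).totalDegree := by
    rw [Nat.one_le_iff_ne_zero]
    intro h0
    rw [totalDegree_eq_zero_iff_eq_C] at h0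
    have e1 := congrArg (eval 0) h0
    have e2 := congrArg (eval ![1, 0]) h0
    simp only [map_sub, map_one, eval_X, eval_C, Matrix.cons_val_zero, Matrix.cons_val_one,
      Pi.zero_apply] at e1 e2
    linarith
  rw [totalDegree_mul_of_isDomain hl hq] at hdeg
  exact absurd (eq_zero_of_triIntegral_mul_sq (horth q (by omega))) hq

end

/-! ### Linear independence of the b^refl_{p,k} through leading forms. -/

section

open Polynomial Finset

/-- In `ℝ[X][X]` the inner variable is the position t on the line x₁ + x₂ = 1 and the outer one a
scaling factor, so the coefficient of order n extracts the degree-n form at (t, 1 - t). -/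
theorem coeff_aeval_of_natDegree_le {n : ℕ} {q : ℝ[X]} (hq : q.natDegree ≤ n) {r : ℝ[X][X]}
    (hr : r.natDegree ≤ 1) : (aeval r q).coeff n = C (q.coeff n) * r.coeff 1 ^ n := by
  rw [aeval_eq_sum_range' (Nat.lt_succ_of_le hq), finsetSum_coeff, sum_range_succ, sum_eq_zero,
    zero_add, coeff_smul, smul_eq_C_mul]
  · have := coeff_pow_of_natDegree_le hr (m := n)
    rw [mul_one] at this
    rw [this]
  · intro i hi
    rw [coeff_smul, coeff_eq_zero_of_natDegree_lt (p := r ^ i), smul_zero]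
    have := mem_range.mp hi
    exact (natDegree_pow_le.trans (Nat.mul_le_mul_left _ hr)).trans_lt (by omega)

theorem aeval_bPoly {S : Type*} [CommRing S] [Algebra ℝ S] (n k : ℕ) (x : Fin 2 → S) :
    MvPolynomial.aeval x (bPoly n k) =
      (∑ j ∈ range (k + 1), algebraMap ℝ S ((legendre k).coeff j) * (x 0 - x 1) ^ j *
        (x 0 + x 1) ^ (k - j)) *
      aeval (2 * (x 0 + x 1) - 1) (jacobi (n - k) 0 (2 * (k : ℝ) + 1)) := by
  rw [bPoly, map_mul, ← Polynomial.aeval_algHom_apply]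
  simp [MvPolynomial.algHom_C]

theorem aeval_rotRM {S : Type*} [CommRing S] [Algebra ℝ S] (x : Fin 2 → S)
    (f : MvPolynomial (Fin 2) ℝ) :
    MvPolynomial.aeval x (rotRM f) = MvPolynomial.aeval ![x 1, 1 - x 0 - x 1] f := by
  rw [rotRM, ← AlgHom.comp_apply, MvPolynomial.comp_aeval]
  congr 2
  ext i
  fin_cases i <;> simp

/-- The leading form of `b_{n,k}` along the line `x₁ + x₂ = 1`. -/
theorem coeff_aeval_bPoly {n k : ℕ} (hk : k ≤ n) :
    (MvPolynomial.aeval (![C X * X, C (1 - X) * X] : Fin 2 → ℝ[X][X]) (bPoly n k)).coeff n =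
      C ((jacobi (n - k) 0 (2 * (k : ℝ) + 1)).coeff (n - k) * 2 ^ (n - k)) *
        (legendre k).comp (2 * X - 1) := by
  rw [aeval_bPoly]
  simp only [Matrix.cons_val_zero, Matrix.cons_val_one]
  have e0 : (C X * X + C (1 - X) * X : ℝ[X][X]) = X := by
    rw [← add_mul, ← C_add]; simp
  have e1 : (C X * X - C (1 - X) * X : ℝ[X][X]) = C (2 * X - 1) * X := by
    rw [← sub_mul, ← C_sub]; congr 2; ring
  have e2 : (∑ j ∈ range (k + 1), algebraMap ℝ ℝ[X][X] ((legendre k).coeff j) *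
      (C (2 * X - 1) * X) ^ j * X ^ (k - j) : ℝ[X][X]) =
      C ((legendre k).comp (2 * X - 1)) * X ^ k := by
    have h2 : (legendre k).natDegree < k + 1 := Nat.lt_succ_of_le (natDegree_jacobi_le k 0 0)
    rw [comp, eval₂_eq_sum_range' _ h2, map_sum, sum_mul]
    refine sum_congr rfl fun j hj => ?_
    have hj' := Nat.lt_succ_iff.mp (mem_range.mp hj)
    rw [mul_pow, mul_assoc, mul_assoc (C _ ^ j), ← pow_add, Nat.add_sub_cancel' hj', C_mul, C_pow,
      ← mul_assoc]
    rfl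
  have h3 : (2 * X - 1 : ℝ[X][X]).natDegree ≤ 1 := by compute_degree
  rw [e0, e1, e2, mul_assoc, coeff_C_mul, ← Nat.sub_add_cancel hk, coeff_X_pow_mul,
    Nat.sub_add_cancel hk, coeff_aeval_of_natDegree_le (natDegree_jacobi_le _ _ _) h3, mul_comm]
  congr 1
  have : (2 * X - 1 : ℝ[X][X]).coeff 1 = C 2 := by
    rw [show (2 : ℝ[X][X]) = C (C 2) from (by rw [map_ofNat, map_ofNat]), coeff_sub, coeff_C_mul]
    simp [coeff_one]
  rw [this, C_mul, C_pow]

/-- The leading form of the rotated `b_{n,k}` is divisible by a high power. -/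
theorem X_pow_dvd_coeff_aeval_bPoly {n k : ℕ} (hk : k ≤ n) :
    (X : ℝ[X]) ^ (n - k) ∣
      (MvPolynomial.aeval (![C (1 - X) * X, 1 - X] : Fin 2 → ℝ[X][X]) (bPoly n k)).coeff n := by
  rw [aeval_bPoly]
  simp only [Matrix.cons_val_zero, Matrix.cons_val_one]
  have d0 : (C (1 - X) * X + (1 - X) : ℝ[X][X]).natDegree ≤ 1 := by compute_degree
  have d1 : (C (1 - X) * X - (1 - X) : ℝ[X][X]).natDegree ≤ 1 := by compute_degree
  have d2 : (2 * (C (1 - X) * X + (1 - X)) - 1 : ℝ[X][X]).natDegree ≤ 1 := by compute_degree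
  have d3 : (∑ j ∈ range (k + 1), algebraMap ℝ ℝ[X][X] ((legendre k).coeff j) *
      (C (1 - X) * X - (1 - X)) ^ j * (C (1 - X) * X + (1 - X)) ^ (k - j) : ℝ[X][X]).natDegree
      ≤ k := by
    refine natDegree_sum_le_of_forall_le _ _ fun j hj => ?_
    have hj' := Nat.lt_succ_iff.mp (mem_range.mp hj)
    have a1 := natDegree_pow_le.trans (Nat.mul_le_mul_left j d1)
    have a2 := natDegree_pow_le.trans (Nat.mul_le_mul_left (k - j) d0)
    rw [show algebraMap ℝ ℝ[X][X] ((legendre k).coeff j) = C (C ((legendre k).coeff j)) from rfl,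
      mul_assoc]
    refine (natDegree_C_mul_le _ _).trans (natDegree_mul_le.trans ?_)
    omega
  have d4 : (aeval (2 * (C (1 - X) * X + (1 - X)) - 1 : ℝ[X][X])
      (jacobi (n - k) 0 (2 * (k : ℝ) + 1))).natDegree ≤ n - k := by
    rw [aeval_eq_sum_range' (Nat.lt_succ_of_le (natDegree_jacobi_le _ _ _))]
    refine natDegree_sum_le_of_forall_le _ _ fun j hj => ?_
    have hj' := Nat.lt_succ_iff.mp (mem_range.mp hj)
    refine (natDegree_smul_le _ _).trans ((natDegree_pow_le.trans (Nat.mul_le_mul_left j d2)).trans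
      ?_)
    omega
  have hc := coeff_mul_add_eq_of_natDegree_le d3 d4
  rw [Nat.add_sub_cancel' hk] at hc
  rw [hc, coeff_aeval_of_natDegree_le (natDegree_jacobi_le _ _ _) d2]
  -- After rotation the coordinate sum is 1 - t s, with s the scaling factor. Its slope -t enters to
  -- the power n - k through the Jacobi factor.
  have : (2 * (C (1 - X) * X + (1 - X)) - 1 : ℝ[X][X]).coeff 1 = -2 * X := by
    rw [show (2 : ℝ[X][X]) = C (C 2) from (by rw [map_ofNat, map_ofNat]), coeff_sub, coeff_C_mul]
    simp [coeff_one]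
    rw [show (C 2 : ℝ[X]) = 2 from map_ofNat C 2]
    ring
  rw [this, mul_pow]
  exact Dvd.intro_left _ (by rw [← mul_assoc, ← mul_assoc])

theorem linearIndependent_legendre : LinearIndependent ℝ legendre :=
  Polynomial.Sequence.linearIndependent
    ⟨legendre, fun n => by
      have h := natDegree_jacobi n 0
      rw [← legendre_eq_jacobi] at h
      rw [degree_eq_natDegree, h]
      intro h0
      have := coeff_jacobi_self_ne_zero n 0
      rw [← legendre_eq_jacobi, h0] at this
      simp at this⟩

theorem linearIndependent_bRefl (p : ℕ) :
    LinearIndependent ℝ (fun k : Fin (dRefl p) => bRefl p k) := by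
  rw [Fintype.linearIndependent_iff]
  intro c hc
  have hk2 : ∀ k : Fin (dRefl p), 2 * (k : ℕ) ≤ p := fun k => two_mul_le_of_lt_dRefl k.2
  set u : MvPolynomial (Fin 2) ℝ := ∑ k : Fin (dRefl p), c k • bPoly p (2 * k) with hu
  have h1 : 2 * u - rotRM u - rotMR u = 0 := by
    have e : (1 / 3 : ℝ) • (2 * u - rotRM u - rotMR u) = 0 := by
      rw [← hc, hu, map_sum, map_sum, mul_sum, ← sum_sub_distrib, ← sum_sub_distrib, smul_sum]
      refine sum_congr rfl fun k _ => ?_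
      rw [map_smul, map_smul, bRefl, ← MvPolynomial.smul_eq_C_mul, smul_comm (c k), mul_smul_comm,
        ← smul_sub, ← smul_sub]
    exact (smul_eq_zero.mp e).resolve_left (by norm_num)
  -- Subtracting the relation 2u = RM u + MR u from its own rotation leaves 3(RM u - u) = 0.
  have h2 : rotRM u = u := by
    have h3 := congrArg rotRM h1
    simp only [map_sub, map_mul, map_ofNat, map_zero, rotRM_rotRM, rotRM_rotMR] at h3
    have h4 : (3 : MvPolynomial (Fin 2) ℝ) * (rotRM u - u) = 0 := by linear_combination h3 - h1
    exact sub_eq_zero.mp ((mul_eq_zero.mp h4).resolve_left (by norm_num))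
  -- These are the Legendre coefficients of the leading form of u; the factors multiplying `c k` are
  -- nonzero.
  set a : Fin (dRefl p) → ℝ := fun k => c k *
    ((jacobi (p - 2 * k) 0 (2 * ((2 * k : ℕ) : ℝ) + 1)).coeff (p - 2 * k) * 2 ^ (p - 2 * (k : ℕ)))
    with ha
  set g : ℝ[X] := ∑ k : Fin (dRefl p), a k • legendre (2 * k) with hg
  set f : ℝ[X] := g.comp (2 * X - 1) with hf
  have f1 : (MvPolynomial.aeval (![C X * X, C (1 - X) * X] : Fin 2 → ℝ[X][X]) u).coeff p = f := by
    rw [hu, map_sum, finsetSum_coeff, hf, hg, ← coe_compRingHom_apply, map_sum]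
    refine sum_congr rfl fun k _ => ?_
    rw [map_smul, coeff_smul, coeff_aeval_bPoly (hk2 k), coe_compRingHom_apply, smul_comp, ha,
      ← smul_eq_C_mul, smul_smul]
  -- By invariance the leading form may be computed from RM u, where the k-th term carries t^(p-2k).
  -- The smallest exponent belongs to k = d - 1.
  have f2 : X ^ (p - 2 * (dRefl p - 1)) ∣ f := by
    rw [← f1, ← h2, aeval_rotRM]
    have e : (![(![C X * X, C (1 - X) * X] : Fin 2 → ℝ[X][X]) 1,
        1 - (![C X * X, C (1 - X) * X] : Fin 2 → ℝ[X][X]) 0 -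
          (![C X * X, C (1 - X) * X] : Fin 2 → ℝ[X][X]) 1] : Fin 2 → ℝ[X][X]) =
        ![C (1 - X) * X, 1 - X] := by
      ext1 i
      fin_cases i
      · simp
      · simp
        ring
    rw [e, hu, map_sum, finsetSum_coeff]
    refine dvd_sum fun k _ => ?_
    rw [map_smul, coeff_smul]
    refine dvd_smul_of_dvd _ ?_
    exact (pow_dvd_pow _ (by have := k.2; omega)).trans (X_pow_dvd_coeff_aeval_bPoly (hk2 k))
  have f3 : f.comp (1 - X) = f := by
    have g1 : g.comp (-X) = g := by
      rw [hg, ← coe_compRingHom_apply, map_sum]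
      refine sum_congr rfl fun k _ => ?_
      rw [coe_compRingHom_apply, smul_comp, legendre_comp_neg_X]
    rw [hf]
    nth_rw 2 [← g1]
    rw [comp_assoc, comp_assoc]
    congr 1
    simp
    ring
  have f4 : (1 - X) ^ (p - 2 * (dRefl p - 1)) ∣ f := by
    obtain ⟨w, hw⟩ := f2
    refine ⟨w.comp (1 - X), ?_⟩
    rw [← f3]
    nth_rw 1 [hw]
    simp
  have f5 : f.natDegree ≤ 2 * (dRefl p - 1) := by
    refine natDegree_comp_le.trans ?_
    have hg : g.natDegree ≤ 2 * (dRefl p - 1) := by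
      refine natDegree_sum_le_of_forall_le _ _ fun k _ => ?_
      refine (natDegree_smul_le _ _).trans ((natDegree_jacobi_le _ _ _).trans ?_)
      have := k.2
      omega
    have : (2 * X - 1 : ℝ[X]).natDegree ≤ 1 := by compute_degree
    exact (Nat.mul_le_mul hg this).trans (mul_one _).le
  intro k
  have f0 : f = 0 := by
    by_contra hne
    have hcop : IsCoprime (X ^ (p - 2 * (dRefl p - 1)) : ℝ[X])
        ((1 - X) ^ (p - 2 * (dRefl p - 1))) :=
      IsCoprime.pow ⟨1, 1, by ring⟩
    -- Together with `f5` this gives 2(p - 2(d-1)) ≤ 2(d-1), that is p ≤ 3(d-1), contradicting 3d ≤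
    -- p + 2.
    have hd := natDegree_le_of_dvd (hcop.mul_dvd f2 f4) hne
    have e : (1 - X : ℝ[X]).natDegree = 1 := by
      rw [show (1 - X : ℝ[X]) = -(X - C 1) by simp, natDegree_neg, natDegree_X_sub_C]
    have e' : (1 - X : ℝ[X]) ≠ 0 := fun h => by simp [h] at e
    rw [natDegree_mul (pow_ne_zero _ X_ne_zero) (pow_ne_zero _ e'), natDegree_X_pow, natDegree_pow,
      e] at hd
    have := k.2
    unfold dRefl at *
    omega
  have g0 : g = 0 := by
    have h := congrArg (fun q => q.comp (C (1 / 2) * (X + 1))) f0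
    simp only [hf, comp_assoc, zero_comp] at h
    have e : (2 * X - 1 : ℝ[X]).comp (C (1 / 2) * (X + 1)) = X := by
      rw [show (2 : ℝ[X]) = C 2 from (map_ofNat C 2).symm]
      simp only [sub_comp, mul_comp, C_comp, X_comp, one_comp, ← mul_assoc, ← C_mul]
      norm_num
    rwa [e, comp_X] at h
  have hli := linearIndependent_legendre.comp (fun k : Fin (dRefl p) => 2 * (k : ℕ))
    (fun i j h => Fin.ext (by simpa using h))
  have := Fintype.linearIndependent_iff.mp hli a g0 k
  refine (mul_eq_zero.mp this).resolve_right (mul_ne_zero ?_ (by positivity))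
  have := coeff_jacobi_self_ne_zero (p - 2 * k) (2 * (2 * k) + 1)
  push_cast at this ⊢
  exact this

end

/-! ### Unisolvence of the principal lattice of a simplex. -/

section

open MvPolynomial Finset
open scoped Nat

/-- The exponents of total degree at most `p`. -/
def lattice (n p : ℕ) : Set (Fin n →₀ ℕ) := {s | ∑ i, s i ≤ p}

theorem finite_lattice (n p : ℕ) : (lattice n p).Finite := by
  refine Set.Finite.subset (Set.finite_Iic (Finsupp.equivFunOnFinite.symm fun _ : Fin n => p))
    fun s hs i => ?_
  have := single_le_sum (f := fun i => s i) (fun _ _ => Nat.zero_le _) (mem_univ i)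
  exact this.trans hs

/-- The (unnormalized) Lagrange polynomial of a lattice point. -/
noncomputable def lagrange (n p : ℕ) (s : Fin n →₀ ℕ) : MvPolynomial (Fin n) ℝ :=
  (∏ i, Polynomial.aeval (X i) (descPochhammer ℝ (s i))) *
    Polynomial.aeval (C (p : ℝ) - ∑ i, X i) (descPochhammer ℝ (p - ∑ i, s i))

theorem totalDegree_lagrange_le {n p : ℕ} {s : Fin n →₀ ℕ} (hs : s ∈ lattice n p) :
    (lagrange n p s).totalDegree ≤ p := by
  refine (totalDegree_mul _ _).trans ?_
  have h1 : (∏ i, Polynomial.aeval (X i : MvPolynomial (Fin n) ℝ)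
      (descPochhammer ℝ (s i))).totalDegree ≤ ∑ i, s i := by
    refine (totalDegree_finsetProd _ _).trans (sum_le_sum fun i _ => ?_)
    refine (totalDegree_polynomial_aeval_le _ _).trans ?_
    rw [descPochhammer_natDegree, totalDegree_X, mul_one]
  have h2 : (Polynomial.aeval (C (p : ℝ) - ∑ i, X i : MvPolynomial (Fin n) ℝ)
      (descPochhammer ℝ (p - ∑ i, s i))).totalDegree ≤ p - ∑ i, s i := by
    refine (totalDegree_polynomial_aeval_le _ _).trans ?_
    rw [descPochhammer_natDegree]
    refine (Nat.mul_le_mul_left _ ?_).trans (mul_one _).le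
    exact totalDegree_sub_le_of_le (by rw [totalDegree_C]; exact zero_le_one)
      (totalDegree_finsetSum_le fun i _ => totalDegree_X_le _ _)
  have hs' : ∑ i, s i ≤ p := hs
  omega

theorem eval_lagrange {n p : ℕ} {s t : Fin n →₀ ℕ} (ht : t ∈ lattice n p) :
    eval (fun i => (t i : ℝ)) (lagrange n p s) =
      (∏ i, ((t i).descFactorial (s i) : ℝ)) *
        ((p - ∑ i, t i).descFactorial (p - ∑ i, s i) : ℝ) := by
  have h : ∀ (q : Polynomial ℝ) (r : MvPolynomial (Fin n) ℝ),
      eval (fun i => (t i : ℝ)) (Polynomial.aeval r q) = q.eval (eval (fun i => (t i : ℝ)) r) := by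
    intro q r
    rw [← coe_aeval_eq_eval, RingHom.coe_coe, ← Polynomial.aeval_algHom_apply,
      Polynomial.coe_aeval_eq_eval]
  have ht' : ∑ i, t i ≤ p := ht
  rw [lagrange, map_mul, map_prod, h]
  simp_rw [h, eval_X, descPochhammer_eval_eq_descFactorial]
  congr 1
  rw [map_sub, eval_C, map_sum]
  simp_rw [eval_X]
  rw [← Nat.cast_sum, ← Nat.cast_sub ht', descPochhammer_eval_eq_descFactorial]

theorem eval_lagrange_self {n p : ℕ} {s : Fin n →₀ ℕ} (hs : s ∈ lattice n p) :
    eval (fun i => (s i : ℝ)) (lagrange n p s) ≠ 0 := by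
  rw [eval_lagrange hs]
  simp only [Nat.descFactorial_self]
  positivity

/-- A falling factorial of t_i of order s_i is nonzero only if s_i ≤ t_i. With the last coordinates
p - ∑ s and p - ∑ t included, both points have coordinate sum p, so a nonzero value forces s = t. -/
theorem eval_lagrange_of_ne {n p : ℕ} {s t : Fin n →₀ ℕ} (hs : s ∈ lattice n p)
    (ht : t ∈ lattice n p) (hst : s ≠ t) : eval (fun i => (t i : ℝ)) (lagrange n p s) = 0 := by
  rw [eval_lagrange ht]
  by_contra hne
  have h1 := left_ne_zero_of_mul hne
  have h2 := right_ne_zero_of_mul hne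
  rw [prod_ne_zero_iff] at h1
  have h3 : ∀ i, s i ≤ t i := fun i => by
    by_contra hlt
    exact h1 i (mem_univ i) (by
      rw [Nat.descFactorial_eq_zero_iff_lt.mpr (not_le.mp hlt), Nat.cast_zero])
  have h4 : p - ∑ i, s i ≤ p - ∑ i, t i := by
    by_contra hlt
    exact h2 (by rw [Nat.descFactorial_eq_zero_iff_lt.mpr (not_le.mp hlt), Nat.cast_zero])
  have hs' : ∑ i, s i ≤ p := hs
  have ht' : ∑ i, t i ≤ p := ht
  have h5 := sum_le_sum fun i (_ : i ∈ (univ : Finset (Fin n))) => h3 i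
  have h6 : ∑ i, s i = ∑ i, t i := by omega
  have h7 := (sum_eq_sum_iff_of_le fun i (_ : i ∈ (univ : Finset (Fin n))) => h3 i).mp h6
  exact hst (Finsupp.ext fun i => h7 i (mem_univ i))

/-- Interpolation on the lattice points of a simplex. -/
theorem exists_interpolant (n p : ℕ) (v : (Fin n →₀ ℕ) → ℝ) :
    ∃ f : MvPolynomial (Fin n) ℝ, f.totalDegree ≤ p ∧
      ∀ s ∈ lattice n p, eval (fun i => (s i : ℝ)) f = v s := by
  refine ⟨∑ s ∈ (finite_lattice n p).toFinset,
    C (v s / eval (fun i => (s i : ℝ)) (lagrange n p s)) * lagrange n p s,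
    totalDegree_finsetSum_le fun s hs => ?_, fun t ht => ?_⟩
  · refine (totalDegree_mul _ _).trans ?_
    rw [totalDegree_C, zero_add]
    exact totalDegree_lagrange_le ((finite_lattice n p).mem_toFinset.mp hs)
  · rw [map_sum, sum_eq_single t]
    · rw [map_mul, eval_C, div_mul_cancel₀ _ (eval_lagrange_self ht)]
    · intro s hs hst
      rw [map_mul, eval_lagrange_of_ne ((finite_lattice n p).mem_toFinset.mp hs) ht hst, mul_zero]
    · intro h
      exact absurd ((finite_lattice n p).mem_toFinset.mpr ht) h

/-- A polynomial of degree at most `p` is determined by its values on the lattice points. -/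
theorem eq_zero_of_eval_lattice {n p : ℕ} {f : MvPolynomial (Fin n) ℝ} (hf : f.totalDegree ≤ p)
    (h : ∀ s ∈ lattice n p, eval (fun i => (s i : ℝ)) f = 0) : f = 0 := by
  have : Fintype (lattice n p) := (finite_lattice n p).fintype
  let toPoly : (lattice n p → ℝ) →ₗ[ℝ] MvPolynomial (Fin n) ℝ :=
    ∑ s : lattice n p, (monomial (s : Fin n →₀ ℕ)).comp (LinearMap.proj s)
  have toPoly_apply : ∀ c, toPoly c = ∑ s : lattice n p, monomial (s : Fin n →₀ ℕ) (c s) :=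
    fun c => by simp [toPoly]
  have toPoly_coeff : ∀ g : MvPolynomial (Fin n) ℝ, g.totalDegree ≤ p →
      toPoly (fun s => coeff s g) = g := by
    intro g hg
    rw [toPoly_apply]
    ext m
    rw [coeff_sum]
    simp_rw [coeff_monomial]
    by_cases hm : m ∈ lattice n p
    · rw [sum_eq_single ⟨m, hm⟩]
      · simp
      · intro s _ hs
        exact if_neg fun h => hs (Subtype.ext h)
      · simp
    · rw [sum_eq_zero, eq_comm]
      · by_contra hne
        refine hm (le_trans ?_ hg)
        have := le_totalDegree (mem_support_iff.mpr hne)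
        rwa [Finsupp.sum_fintype _ _ (by simp)] at this
      · intro s _
        exact if_neg fun h : (s : Fin n →₀ ℕ) = m => hm (h ▸ s.2)
  let values : MvPolynomial (Fin n) ℝ →ₗ[ℝ] (lattice n p → ℝ) :=
    LinearMap.pi fun s => (aeval fun i => ((s : Fin n →₀ ℕ) i : ℝ)).toLinearMap
  have values_apply : ∀ g s, values g s = eval (fun i => ((s : Fin n →₀ ℕ) i : ℝ)) g :=
    fun g s => by
      rw [← coe_aeval_eq_eval]
      rfl
  -- Exponents and nodes are indexed by the same finite set, so this is an endomorphism of a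
  -- finite-dimensional space: surjectivity, supplied by interpolation, gives injectivity.
  have hsurj : Function.Surjective (values ∘ₗ toPoly) := by
    classical
    intro v
    obtain ⟨g, hg, hv⟩ := exists_interpolant n p
      (fun s => if hs : s ∈ lattice n p then v ⟨s, hs⟩ else 0)
    refine ⟨fun s => coeff s g, ?_⟩
    rw [LinearMap.comp_apply, toPoly_coeff g hg]
    ext s
    rw [values_apply, hv s s.2, dif_pos s.2]
  have hinj := LinearMap.injective_iff_surjective.mpr hsurj
  have h0 : (fun s : lattice n p => coeff (s : Fin n →₀ ℕ) f) = 0 := by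
    refine hinj ?_
    rw [LinearMap.comp_apply, toPoly_coeff f hf, map_zero]
    ext s
    rw [values_apply, h s s.2, Pi.zero_apply]
  rw [← toPoly_coeff f hf, h0, map_zero]

theorem aeval_C_mul_X_eval {n : ℕ} (c : ℝ) (x : Fin n → ℝ) (f : MvPolynomial (Fin n) ℝ) :
    eval x (aeval (fun i => C c * X i) f) = eval (fun i => c * x i) f := by
  rw [← coe_aeval_eq_eval, ← coe_aeval_eq_eval, RingHom.coe_coe, RingHom.coe_coe,
    ← AlgHom.comp_apply, comp_aeval]
  congr 2
  ext i
  simp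

theorem totalDegree_C_mul_X_le {n : ℕ} (c : ℝ) (i : Fin n) :
    (C c * X i : MvPolynomial (Fin n) ℝ).totalDegree ≤ 1 := by
  refine (totalDegree_mul _ _).trans ?_
  rw [totalDegree_C, zero_add]
  exact totalDegree_X_le _ _

/-- Polynomials of degree at most `p` agreeing on the nodal points of the unit simplex are equal. -/
theorem eq_of_eval_scaled_lattice {n p : ℕ} (hp : 0 < p) {f g : MvPolynomial (Fin n) ℝ}
    (hf : f.totalDegree ≤ p) (hg : g.totalDegree ≤ p)
    (h : ∀ s ∈ lattice n p, eval (fun i => (s i : ℝ) / p) f = eval (fun i => (s i : ℝ) / p) g) :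
    f = g := by
  have hp' : (p : ℝ) ≠ 0 := by positivity
  have h1 : aeval (fun i => C ((p : ℝ)⁻¹) * X i) (f - g) = 0 := by
    refine eq_zero_of_eval_lattice (p := p) ((totalDegree_aeval_le
      (fun i => totalDegree_C_mul_X_le _ _) _).trans (totalDegree_sub_le_of_le hf hg)) ?_
    intro s hs
    rw [aeval_C_mul_X_eval, map_sub, sub_eq_zero]
    simpa [div_eq_inv_mul] using h s hs
  rw [← sub_eq_zero]
  refine MvPolynomial.funext fun x => ?_
  have h2 := congrArg (eval fun i => p * x i) h1
  rw [aeval_C_mul_X_eval] at h2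
  simpa [hp'] using h2

theorem exists_interpolant_scaled {n p : ℕ} (hp : 0 < p) (v : (Fin n →₀ ℕ) → ℝ) :
    ∃ f : MvPolynomial (Fin n) ℝ, f.totalDegree ≤ p ∧
      ∀ s ∈ lattice n p, eval (fun i => (s i : ℝ) / p) f = v s := by
  have hp' : (p : ℝ) ≠ 0 := by positivity
  obtain ⟨f, hf, hv⟩ := exists_interpolant n p v
  refine ⟨aeval (fun i => C (p : ℝ) * X i) f, (totalDegree_aeval_le
    (fun i => totalDegree_C_mul_X_le _ _) _).trans hf, fun s hs => ?_⟩
  rw [aeval_C_mul_X_eval, ← hv s hs]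
  congr 2
  ext i
  field_simp

end

/-! ### Barycentric coordinates of the tetrahedron and gluing over the facets at a vertex. -/

section

open MvPolynomial Finset

/-- The vertices of a tetrahedron as an affine basis. -/
noncomputable def vertexBasis (A : Fin 4 → Fin 3 → ℝ) (hA : AffineIndependent ℝ A) :
    AffineBasis (Fin 4) ℝ (Fin 3 → ℝ) :=
  ⟨A, hA, hA.affineSpan_eq_top_iff_card_eq_finrank_add_one.mpr (by simp)⟩

/-- The barycentric coordinates of a tetrahedron as polynomials. -/
noncomputable def bary (A : Fin 4 → Fin 3 → ℝ) (hA : AffineIndependent ℝ A) (j : Fin 4) :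
    MvPolynomial (Fin 3) ℝ :=
  C ((vertexBasis A hA).coord j 0) +
    ∑ i, C (((vertexBasis A hA).coord j).linear (Pi.single i 1)) * X i

section

variable (A : Fin 4 → Fin 3 → ℝ) (hA : AffineIndependent ℝ A)

theorem totalDegree_bary_le (j : Fin 4) : (bary A hA j).totalDegree ≤ 1 := by
  refine totalDegree_add_le_of_le (by rw [totalDegree_C]; exact zero_le_one)
    (totalDegree_finsetSum_le fun i _ => totalDegree_C_mul_X_le _ _)

theorem eval_bary (j : Fin 4) (y : Fin 3 → ℝ) :
    eval y (bary A hA j) = (vertexBasis A hA).coord j y := by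
  have h := congrFun ((vertexBasis A hA).coord j).decomp y
  rw [Pi.add_apply] at h
  rw [h, LinearMap.pi_apply_eq_sum_univ ((vertexBasis A hA).coord j).linear y, bary, map_add,
    map_sum, eval_C, add_comm]
  congr 1
  refine sum_congr rfl fun i _ => ?_
  rw [map_mul, eval_C, eval_X, smul_eq_mul, mul_comm]
  congr 3
  ext k
  simp [Pi.single_apply, eq_comm]

theorem eval_bary_vertex (i j : Fin 4) : eval (A i) (bary A hA j) = if i = j then 1 else 0 := by
  rw [eval_bary]
  have := (vertexBasis A hA).coord_apply j i
  simp only [eq_comm (a := j)] at this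
  exact this

theorem sum_eval_bary (y : Fin 3 → ℝ) : ∑ j, eval y (bary A hA j) = 1 := by
  simp_rw [eval_bary]
  exact (vertexBasis A hA).sum_coord_apply_eq_one y

theorem sum_eval_bary_smul (y : Fin 3 → ℝ) : ∑ j, eval y (bary A hA j) • A j = y := by
  simp_rw [eval_bary]
  exact (vertexBasis A hA).linear_combination_coord_eq_self y

theorem eval_bary_sum (j : Fin 4) {ι : Type*} (s : Finset ι) (w : ι → ℝ) (z : ι → Fin 3 → ℝ)
    (hw : ∑ k ∈ s, w k = 1) :
    eval (∑ k ∈ s, w k • z k) (bary A hA j) = ∑ k ∈ s, w k * eval (z k) (bary A hA j) := by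
  simp only [bary, map_add, map_sum, map_mul, eval_C, eval_X, mul_add, sum_add_distrib,
    ← sum_mul, hw, one_mul, Finset.sum_apply, Pi.smul_apply, smul_eq_mul, mul_sum]
  rw [sum_comm (s := s)]
  congr 1
  refine sum_congr rfl fun i _ => sum_congr rfl fun k _ => ?_
  ring

theorem eval_bary_sum_vertex (j : Fin 4) {w : Fin 4 → ℝ} (hw : ∑ k, w k = 1) :
    eval (∑ k, w k • A k) (bary A hA j) = w j := by
  rw [eval_bary_sum A hA j _ _ _ hw]
  simp [eval_bary_vertex]

theorem triMap_eq_sum {d : ℕ} (P Q R : Fin d → ℝ) (x : Fin 2 → ℝ) :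
    triMap P Q R x =
      ∑ k : Fin 3, (![1 - x 0 - x 1, x 0, x 1] : Fin 3 → ℝ) k •
        (![P, Q, R] : Fin 3 → Fin d → ℝ) k := by
  ext m
  simp [triMap, Fin.sum_univ_three]
  ring

theorem eval_bary_triMap (j a b c : Fin 4) (x : Fin 2 → ℝ) :
    eval (triMap (A a) (A b) (A c) x) (bary A hA j) =
      (if a = j then 1 - x 0 - x 1 else 0) + (if b = j then x 0 else 0) +
        (if c = j then x 1 else 0) := by
  rw [triMap_eq_sum, eval_bary_sum A hA j _ _ _ (by simp [Fin.sum_univ_three]; ring)]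
  simp [Fin.sum_univ_three, eval_bary_vertex]

theorem triMap_mem_facet {j a b c : Fin 4} (ha : a ≠ j) (hb : b ≠ j) (hc : c ≠ j)
    {x : Fin 2 → ℝ} (hx : x ∈ refTriangle) : triMap (A a) (A b) (A c) x ∈ facet A j := by
  rw [triMap_eq_sum]
  refine (convex_convexHull ℝ _).sum_mem (fun k _ => ?_) (by simp [Fin.sum_univ_three]; ring)
    fun k _ => subset_convexHull ℝ _ ?_
  · obtain ⟨h0, h1, h2⟩ := hx
    fin_cases k
    · simp; linarith
    · simpa
    · simpa
  · fin_cases k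
    · exact ⟨a, ha, rfl⟩
    · exact ⟨b, hb, rfl⟩
    · exact ⟨c, hc, rfl⟩

theorem univ_eq_of_distinct {j a b c : Fin 4} (ha : a ≠ j) (hb : b ≠ j) (hc : c ≠ j)
    (hab : a ≠ b) (hac : a ≠ c) (hbc : b ≠ c) : (univ : Finset (Fin 4)) = {j, a, b, c} := by
  revert j a b c; decide

theorem exists_of_mem_facet {j a b c : Fin 4} (ha : a ≠ j) (hb : b ≠ j) (hc : c ≠ j)
    (hab : a ≠ b) (hac : a ≠ c) (hbc : b ≠ c) {y : Fin 3 → ℝ} (hy : y ∈ facet A j) :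
    ![eval y (bary A hA b), eval y (bary A hA c)] ∈ refTriangle ∧
      y = triMap (A a) (A b) (A c) ![eval y (bary A hA b), eval y (bary A hA c)] := by
  -- The set described by these conditions is convex and contains the vertices of the facet, hence
  -- the whole facet.
  have hy' : (∀ k, 0 ≤ eval y (bary A hA k)) ∧ eval y (bary A hA j) = 0 := by
    refine convexHull_min (s := A '' {k | k ≠ j})
      (t := {y | (∀ k, 0 ≤ eval y (bary A hA k)) ∧ eval y (bary A hA j) = 0}) ?_ ?_ hy
    · rintro _ ⟨i, hi, rfl⟩
      refine ⟨fun k => ?_, ?_⟩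
      · rw [eval_bary_vertex]
        split_ifs <;> norm_num
      · rw [eval_bary_vertex, if_neg hi]
    · intro y1 h1 y2 h2 u v hu hv huv
      have hl : ∀ k, eval (u • y1 + v • y2) (bary A hA k) =
          u * eval y1 (bary A hA k) + v * eval y2 (bary A hA k) := by
        intro k
        have := eval_bary_sum A hA k univ ![u, v] ![y1, y2] (by simpa [Fin.sum_univ_two] using huv)
        simpa [Fin.sum_univ_two] using this
      refine ⟨fun k => ?_, ?_⟩
      · rw [hl]
        exact add_nonneg (mul_nonneg hu (h1.1 k)) (mul_nonneg hv (h2.1 k))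
      · rw [hl, h1.2, h2.2, mul_zero, mul_zero, add_zero]
  have huniv := univ_eq_of_distinct ha hb hc hab hac hbc
  have hs := sum_eval_bary A hA y
  have hv := sum_eval_bary_smul A hA y
  rw [huniv, sum_insert (by simp [ha.symm, hb.symm, hc.symm]), sum_insert (by simp [hab, hac]),
    sum_insert (by simp [hbc]), sum_singleton, hy'.2] at hs hv
  refine ⟨⟨hy'.1 b, hy'.1 c, ?_⟩, ?_⟩
  · have := hy'.1 a
    simp
    linarith
  · conv_lhs => rw [← hv]
    have e : eval y (bary A hA a) = 1 - eval y (bary A hA b) - eval y (bary A hA c) := by linarith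
    rw [e]
    ext m
    simp [triMap]
    ring

end

theorem eval_congr_of_coords {f : MvPolynomial (Fin 2) ℝ} {x x' : Fin 2 → ℝ} (h0 : x 0 = x' 0)
    (h1 : x 1 = x' 1) : eval x f = eval x' f := by
  rw [show x = x' from funext fun i => by fin_cases i <;> assumption]

theorem eval_swap_of_coords {f : MvPolynomial (Fin 2) ℝ}
    (hf : ∀ s t : ℝ, eval ![s, t] f = eval ![t, s] f) {x x' : Fin 2 → ℝ} (h0 : x 0 = x' 1)
    (h1 : x 1 = x' 0) : eval x f = eval x' f := by
  rw [eval_congr_of_coords (x := x) (x' := ![x 0, x 1]) rfl rfl, hf]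
  exact eval_congr_of_coords h1 h0

/-- A symmetric function lifted to the facets through `A i` is well defined. -/
theorem eval_eq_of_triMap_eq (A : Fin 4 → Fin 3 → ℝ) (hA : AffineIndependent ℝ A)
    {f : MvPolynomial (Fin 2) ℝ} (hf : ∀ s t : ℝ, eval ![s, t] f = eval ![t, s] f)
    {i a b a' b' : Fin 4} (ha : a ≠ i) (hb : b ≠ i) (hab : a ≠ b) (ha' : a' ≠ i) (hb' : b' ≠ i)
    (hab' : a' ≠ b') {x x' : Fin 2 → ℝ}
    (h : triMap (A i) (A a) (A b) x = triMap (A i) (A a') (A b') x') :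
    eval x f = eval x' f := by
  have key : ∀ j, _ := fun j => by
    have := congrArg (fun y => eval y (bary A hA j)) h
    simp only [eval_bary_triMap] at this
    exact this
  have ka := key a
  have kb := key b
  have ka' := key a'
  have kb' := key b'
  simp only [ha.symm, hb.symm, ha'.symm, hb'.symm, hab, hab.symm, hab', hab'.symm, if_true,
    if_false, zero_add, add_zero] at ka kb ka' kb'
  by_cases h1 : a = a'
  · subst h1
    by_cases h2 : b = b'
    · subst h2
      exact eval_congr_of_coords (by simpa [hab.symm] using ka) (by simpa [hab] using kb)
    -- The point lies on the edge shared by two facets, so the coordinates at b and b' both vanish.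
    · simp only [hab, hab', hab'.symm, h2, Ne.symm h2, if_true, if_false, add_zero] at ka kb kb'
      exact eval_congr_of_coords ka (by rw [kb, ← kb'])
  · by_cases h2 : b = b'
    · subst h2
      simp only [hab', hab.symm, hab'.symm, h1, Ne.symm h1, if_true, if_false, zero_add,
        add_zero] at ka kb ka'
      exact eval_congr_of_coords (by rw [ka, ← ka']) kb
    · by_cases h3 : a = b'
      · subst h3
        by_cases h4 : b = a'
        · subst h4
          simp only [hab, hab.symm, if_true, if_false, zero_add, add_zero] at ka kb
          exact eval_swap_of_coords hf ka kb
        · simp only [hab, hab', hab'.symm, h4, Ne.symm h4, if_true, if_false, zero_add, add_zero] at ka kb ka'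
          exact eval_swap_of_coords hf ka (by rw [kb, ← ka'])
      · by_cases h4 : b = a'
        · subst h4
          simp only [hab', hab.symm, hab'.symm, h3, Ne.symm h3, if_true, if_false, add_zero] at ka kb kb'
          exact eval_swap_of_coords hf (by rw [ka, ← kb']) kb
        -- Four distinct indices other than i cannot exist, but the comparison settles this case as
        -- well: all coordinates vanish.
        · simp only [h1, h2, h3, h4, Ne.symm h1, Ne.symm h2, Ne.symm h3, Ne.symm h4, if_false,
            add_zero] at ka kb ka' kb'
          exact eval_congr_of_coords (by rw [ka, ← ka']) (by rw [kb, ← kb'])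

/-- `v` is a value at `y` of `f` lifted to the facets through `A i`. -/
def IsPatchValue (A : Fin 4 → Fin 3 → ℝ) (i : Fin 4) (f : MvPolynomial (Fin 2) ℝ)
    (y : Fin 3 → ℝ) (v : ℝ) : Prop :=
  ∃ a b : Fin 4, a ≠ i ∧ b ≠ i ∧ a ≠ b ∧ ∃ x ∈ refTriangle,
    y = triMap (A i) (A a) (A b) x ∧ v = eval x f

open Classical in
/-- `f` lifted to the facets through `A i`, with the value `e` elsewhere. -/
noncomputable def patch (A : Fin 4 → Fin 3 → ℝ) (i : Fin 4) (f : MvPolynomial (Fin 2) ℝ)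
    (e : ℝ) (y : Fin 3 → ℝ) : ℝ :=
  if h : ∃ v, IsPatchValue A i f y v then h.choose else e

theorem patch_eq (A : Fin 4 → Fin 3 → ℝ) (hA : AffineIndependent ℝ A)
    {f : MvPolynomial (Fin 2) ℝ} (hf : ∀ s t : ℝ, eval ![s, t] f = eval ![t, s] f) (e : ℝ)
    {i a b : Fin 4} (ha : a ≠ i) (hb : b ≠ i) (hab : a ≠ b) {x : Fin 2 → ℝ}
    (hx : x ∈ refTriangle) {y : Fin 3 → ℝ} (hy : y = triMap (A i) (A a) (A b) x) :
    patch A i f e y = eval x f := by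
  have h : ∃ v, IsPatchValue A i f y v := ⟨_, a, b, ha, hb, hab, x, hx, hy, rfl⟩
  rw [patch, dif_pos h]
  obtain ⟨a', b', ha', hb', hab', x', -, hy', hv⟩ := h.choose_spec
  rw [hv]
  exact eval_eq_of_triMap_eq A hA hf ha' hb' hab' ha hb hab (hy'.symm.trans hy)

theorem exists_other_two (i j : Fin 4) (h : j ≠ i) :
    ∃ a b : Fin 4, a ≠ i ∧ b ≠ i ∧ a ≠ b ∧ a ≠ j ∧ b ≠ j := by
  revert i j; decide

theorem exists_other (i a b : Fin 4) : ∃ j : Fin 4, j ≠ i ∧ j ≠ a ∧ j ≠ b := by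
  revert i a b; decide

end

/-! ### Totally symmetric extension of edge values and existence of the surface functions. -/

section

open MvPolynomial Finset

/-- Symmetry gives g(0) = g(1), so X(1 - X) divides g - g(0). The quotient is again symmetric and
has degree smaller by two. -/
theorem exists_comp_X_mul_one_sub_X (n : ℕ) (g : Polynomial ℝ) (hn : g.natDegree ≤ n)
    (hg : g.comp (1 - Polynomial.X) = g) :
    ∃ h : Polynomial ℝ, 2 * h.natDegree ≤ n ∧
      g = h.comp (Polynomial.X * (1 - Polynomial.X)) := by
  induction n using Nat.strong_induction_on generalizing g with
  | _ n ih =>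
    rcases Nat.eq_zero_or_pos g.natDegree with h0 | hpos
    · refine ⟨g, by omega, ?_⟩
      rw [Polynomial.eq_C_of_natDegree_eq_zero h0, Polynomial.C_comp]
    set c := g.eval 0 with hc
    have hc1 : g.eval 1 = c := by
      rw [hc]
      conv_rhs => rw [← hg]
      simp
    have hd : (Polynomial.X * (1 - Polynomial.X) : Polynomial ℝ) ∣ g - Polynomial.C c := by
      refine IsCoprime.mul_dvd ⟨1, 1, by ring⟩ ?_ ?_
      · rw [Polynomial.X_dvd_iff, Polynomial.coeff_zero_eq_eval_zero]
        simp [hc]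
      · rw [show (1 - Polynomial.X : Polynomial ℝ) = -(Polynomial.X - Polynomial.C 1) by simp,
          neg_dvd, Polynomial.dvd_iff_isRoot, Polynomial.IsRoot]
        simp [hc1]
    obtain ⟨q, hq⟩ := hd
    have hm : (Polynomial.X * (1 - Polynomial.X) : Polynomial ℝ).natDegree = 2 := by
      rw [show (1 - Polynomial.X : Polynomial ℝ) = -(Polynomial.X - Polynomial.C 1) by simp,
        mul_neg, Polynomial.natDegree_neg, Polynomial.natDegree_mul Polynomial.X_ne_zero
          (Polynomial.X_sub_C_ne_zero 1), Polynomial.natDegree_X, Polynomial.natDegree_X_sub_C]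
    have hm0 : (Polynomial.X * (1 - Polynomial.X) : Polynomial ℝ) ≠ 0 := fun h => by
      simp [h] at hm
    have hq0 : q ≠ 0 := by
      rintro rfl
      rw [mul_zero, sub_eq_zero] at hq
      rw [hq, Polynomial.natDegree_C] at hpos
      exact lt_irrefl _ hpos
    have hdeg : g.natDegree = 2 + q.natDegree := by
      rw [← Polynomial.natDegree_sub_C (a := c), hq, Polynomial.natDegree_mul hm0 hq0, hm]
    have hqs : q.comp (1 - Polynomial.X) = q := by
      have h1 := congrArg (fun r => r.comp (1 - Polynomial.X)) hq
      simp only [Polynomial.sub_comp, hg, Polynomial.C_comp, Polynomial.mul_comp,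
        Polynomial.X_comp, Polynomial.one_comp] at h1
      rw [hq, sub_sub_cancel, mul_comm (1 - Polynomial.X)] at h1
      exact (mul_left_cancel₀ hm0 h1).symm
    obtain ⟨h, hh, e⟩ := ih (n - 2) (by omega) q (by omega) hqs
    refine ⟨Polynomial.C c + Polynomial.X * h, ?_, ?_⟩
    · have h1 := Polynomial.natDegree_add_le (Polynomial.C c) (Polynomial.X * h)
      have h2 := Polynomial.natDegree_mul_le (p := (Polynomial.X : Polynomial ℝ)) (q := h)
      rw [Polynomial.natDegree_X] at h2
      rw [Polynomial.natDegree_C] at h1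
      omega
    · rw [Polynomial.add_comp, Polynomial.mul_comp, Polynomial.C_comp, Polynomial.X_comp, ← e, ← hq]
      ring

/-- The second elementary symmetric polynomial of the barycentric coordinates. -/
noncomputable def esymmTwo : MvPolynomial (Fin 2) ℝ := X 0 * X 1 + (X 0 + X 1) * (1 - X 0 - X 1)

theorem totalDegree_esymmTwo_le : esymmTwo.totalDegree ≤ 2 := by
  have h0 : (X 0 : MvPolynomial (Fin 2) ℝ).totalDegree ≤ 1 := totalDegree_X_le _ _
  have h1 : (X 1 : MvPolynomial (Fin 2) ℝ).totalDegree ≤ 1 := totalDegree_X_le _ _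
  have h2 : (1 : MvPolynomial (Fin 2) ℝ).totalDegree ≤ 1 := by simp
  refine totalDegree_add_le_of_le ((totalDegree_mul _ _).trans (add_le_add h0 h1))
    ((totalDegree_mul _ _).trans (Nat.add_le_add (b := 1) (d := 1) (totalDegree_add_le_of_le h0 h1)
      (totalDegree_sub_le_of_le (totalDegree_sub_le_of_le h2 h0) h1)))

theorem eval_esymmTwo (x : Fin 2 → ℝ) :
    eval x esymmTwo = x 0 * x 1 + (x 0 + x 1) * (1 - x 0 - x 1) := by
  simp [esymmTwo]

theorem eval_polynomial_aeval {σ : Type*} (x : σ → ℝ) (q : Polynomial ℝ) (r : MvPolynomial σ ℝ) :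
    eval x (Polynomial.aeval r q) = q.eval (eval x r) := by
  rw [← coe_aeval_eq_eval, RingHom.coe_coe, ← Polynomial.aeval_algHom_apply,
    Polynomial.coe_aeval_eq_eval]

theorem isTotallySymmetric_aeval_esymmTwo (h : Polynomial ℝ) :
    IsTotallySymmetric (Polynomial.aeval esymmTwo h) := by
  intro π x _
  rw [eval_polynomial_aeval, eval_polynomial_aeval, eval_esymmTwo, eval_esymmTwo]
  congr 1
  have h01 : π 0 ≠ π 1 := π.injective.ne (by decide)
  have h02 : π 0 ≠ π 2 := π.injective.ne (by decide)
  have h12 : π 1 ≠ π 2 := π.injective.ne (by decide)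
  generalize π 0 = a at *
  generalize π 1 = b at *
  generalize π 2 = c at *
  fin_cases a <;> fin_cases b <;> first | exact absurd rfl h01 | skip
  all_goals fin_cases c <;> first | exact absurd rfl h02 | exact absurd rfl h12 | skip
  all_goals
    simp [triMap, refVertex] <;> ring

theorem natDegree_aeval_le {p : ℕ} {f : MvPolynomial (Fin 2) ℝ} (hf : f.totalDegree ≤ p)
    {x : Fin 2 → Polynomial ℝ} (hx : ∀ i, (x i).natDegree ≤ 1) : (aeval x f).natDegree ≤ p := by
  rw [aeval_def, eval₂_eq]
  refine Polynomial.natDegree_sum_le_of_forall_le _ _ fun s hs => ?_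
  refine (Polynomial.natDegree_C_mul_le _ _).trans ?_
  refine (Polynomial.natDegree_prod_le _ _).trans
    ((sum_le_sum fun i _ => ?_).trans ((le_totalDegree hs).trans hf))
  exact Polynomial.natDegree_pow_le.trans ((Nat.mul_le_mul_left _ (hx i)).trans (mul_one _).le)

/-- A symmetric function on the edge `x₁ + x₂ = 1` is a polynomial in `t (1 - t)`. -/
theorem exists_edge_polynomial {p : ℕ} {f : MvPolynomial (Fin 2) ℝ} (hdeg : f.totalDegree ≤ p)
    (hf : ∀ s t : ℝ, eval ![s, t] f = eval ![t, s] f) :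
    ∃ h : Polynomial ℝ, 2 * h.natDegree ≤ p ∧
      ∀ t : ℝ, eval ![t, 1 - t] f = h.eval (t * (1 - t)) := by
  set g : Polynomial ℝ := aeval ![Polynomial.X, 1 - Polynomial.X] f with hg
  have hge : ∀ t, g.eval t = eval ![t, 1 - t] f := by
    intro t
    rw [hg, ← Polynomial.coe_aeval_eq_eval, ← coe_aeval_eq_eval, RingHom.coe_coe,
      ← AlgHom.comp_apply, comp_aeval]
    congr 2
    ext i
    fin_cases i <;> simp
  obtain ⟨h, hh, e⟩ := exists_comp_X_mul_one_sub_X p g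
    (natDegree_aeval_le hdeg fun i => by
      fin_cases i
      · exact Polynomial.natDegree_X_le
      · exact (Polynomial.natDegree_sub_le _ _).trans (by simp))
    (Polynomial.funext fun t => by
      rw [Polynomial.eval_comp, hge, hge, hf t]
      simp)
  refine ⟨h, hh, fun t => ?_⟩
  rw [← hge, e]
  simp

theorem sum_sq_of_distinct {i a b : Fin 4} (hia : i ≠ a) (hib : i ≠ b) (hab : a ≠ b) (u v w : ℝ) :
    ∑ j, ((if i = j then u else 0) + (if a = j then v else 0) + (if b = j then w else 0)) ^ 2 =
      u ^ 2 + v ^ 2 + w ^ 2 := by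
  have e : ∀ j, ((if i = j then u else 0) + (if a = j then v else 0) +
      (if b = j then w else 0)) ^ 2 = (if i = j then u ^ 2 else 0) + (if a = j then v ^ 2 else 0) +
      (if b = j then w ^ 2 else 0) := by
    intro j
    split_ifs with h1 h2 h3 h4 h5 h6 h7
    all_goals first
      | exact absurd (h1.trans (Eq.symm ‹a = j›)) hia
      | exact absurd (h1.trans (Eq.symm ‹b = j›)) hib
      | exact absurd ((‹a = j›).trans (Eq.symm ‹b = j›)) hab
      | ring
  simp_rw [e, sum_add_distrib]
  simp

theorem exists_isReflSurfaceFun (p : ℕ) (A : Fin 4 → Fin 3 → ℝ) (hA : AffineIndependent ℝ A)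
    (i : Fin 4) (k : Fin (dRefl p)) : ∃ Q : surface A → ℝ, IsReflSurfaceFun p k A i Q := by
  obtain ⟨h, hh, he⟩ := exists_edge_polynomial (totalDegree_bRefl_le k.2) (eval_bRefl_swap p k)
  -- Since the barycentric coordinates λ_j sum to 1, (1 - ∑ λ_j²)/2 is their second elementary
  -- symmetric function. This form is independent of any chart of T_i.
  let e : (Fin 3 → ℝ) → ℝ := fun y => h.eval ((1 - ∑ j, eval y (bary A hA j) ^ 2) / 2)
  refine ⟨fun y => patch A i (bRefl p k) (e y) y, fun a b ha hb hab x hx y hy =>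
    patch_eq A hA (eval_bRefl_swap p k) _ ha hb hab hx hy,
    Polynomial.aeval esymmTwo h, ?_, isTotallySymmetric_aeval_esymmTwo h, fun t _ => ?_,
    fun a b c ha hb hc hab hac hbc x hx y hy => ?_⟩
  · refine (totalDegree_polynomial_aeval_le _ _).trans
      ((Nat.mul_le_mul_left _ totalDegree_esymmTwo_le).trans ?_)
    omega
  · rw [eval_polynomial_aeval, eval_esymmTwo, he]
    congr 1
    simp
  · have hey : e y = eval x (Polynomial.aeval esymmTwo h) := by
      simp only [e]
      rw [eval_polynomial_aeval, eval_esymmTwo, hy]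
      simp_rw [eval_bary_triMap]
      rw [sum_sq_of_distinct hab hac hbc]
      congr 1
      ring
    rw [← hey]
    -- A point of T_i may also lie on a facet through A_i. It is then on an edge of T_i, where the
    -- patch value and the symmetric polynomial agree.
    by_cases hv : ∃ v, IsPatchValue A i (bRefl p k) y v
    · obtain ⟨v, a', b', ha', hb', hab', x', hx', hy', -⟩ := hv
      change patch A i (bRefl p k) (e y) y = e y
      rw [patch_eq A hA (eval_bRefl_swap p k) _ ha' hb' hab' hx' hy']
      have h1 : x' 1 = 1 - x' 0 := by
        have h2 := congrArg (fun z => eval z (bary A hA i)) (hy.symm.trans hy')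
        simp only [eval_bary_triMap, ha, hb, hc, ha', hb', if_true, if_false, add_zero] at h2
        linarith
      rw [eval_congr_of_coords (x := x') (x' := ![x' 0, 1 - x' 0]) rfl h1, he]
      simp only [e]
      rw [hy']
      simp_rw [eval_bary_triMap]
      rw [sum_sq_of_distinct ha'.symm hb'.symm hab', h1]
      congr 1
      ring
    · exact dif_neg hv

end

/-! ### Nodal interpolation on the tetrahedron and the facet-oriented functions. -/

section

open MvPolynomial Finset

/-- The point of `ℝ³` with barycentric coordinates `z` with respect to `A 1`, `A 2`, `A 3`. -/
noncomputable def pointOf (A : Fin 4 → Fin 3 → ℝ) (z : Fin 3 → ℝ) : Fin 3 → ℝ :=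
  ∑ j, (Fin.cons (1 - ∑ i, z i) z : Fin 4 → ℝ) j • A j

/-- The coordinates of `pointOf` as polynomials. -/
noncomputable def pointPoly (A : Fin 4 → Fin 3 → ℝ) (m : Fin 3) : MvPolynomial (Fin 3) ℝ :=
  C (A 0 m) + ∑ i : Fin 3, C (A i.succ m - A 0 m) * X i

theorem eval_aeval_pointPoly (A : Fin 4 → Fin 3 → ℝ) (z : Fin 3 → ℝ) (f : MvPolynomial (Fin 3) ℝ) :
    eval z (aeval (pointPoly A) f) = eval (pointOf A z) f := by
  rw [← coe_aeval_eq_eval, ← coe_aeval_eq_eval, RingHom.coe_coe, RingHom.coe_coe,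
    ← AlgHom.comp_apply, comp_aeval]
  congr 2
  ext m
  simp [pointPoly, pointOf, Fin.sum_univ_succ]
  ring

theorem totalDegree_pointPoly_le (A : Fin 4 → Fin 3 → ℝ) (m : Fin 3) :
    (pointPoly A m).totalDegree ≤ 1 :=
  totalDegree_add_le_of_le (by rw [totalDegree_C]; exact zero_le_one)
    (totalDegree_finsetSum_le fun i _ => totalDegree_C_mul_X_le _ _)

theorem pointOf_bary (A : Fin 4 → Fin 3 → ℝ) (hA : AffineIndependent ℝ A) (y : Fin 3 → ℝ) :
    pointOf A (fun i => eval y (bary A hA i.succ)) = y := by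
  have h := sum_eval_bary A hA y
  conv_rhs => rw [← sum_eval_bary_smul A hA y]
  refine sum_congr rfl fun j _ => ?_
  congr 1
  refine Fin.cases ?_ (fun i => rfl) j
  rw [Fin.sum_univ_succ] at h
  rw [Fin.cons_zero]
  linarith

theorem pointOf_mem_nodes {p : ℕ} (hp : 0 < p) (A : Fin 4 → Fin 3 → ℝ) {s : Fin 3 →₀ ℕ}
    (hs : s ∈ lattice 3 p) : pointOf A (fun i => (s i : ℝ) / p) ∈ nodes p A := by
  have hs' : ∑ i, s i ≤ p := hs
  have hp' : (p : ℝ) ≠ 0 := by positivity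
  refine ⟨Fin.cons (p - ∑ i, s i) s, ?_, ?_⟩
  · rw [Fin.sum_univ_succ]
    simp only [Fin.cons_zero, Fin.cons_succ]
    omega
  · refine sum_congr rfl fun j _ => ?_
    congr 1
    refine Fin.cases ?_ (fun i => ?_) j
    · rw [Fin.cons_zero, Fin.cons_zero, Nat.cast_sub hs', ← sum_div]
      push_cast
      field_simp
    · rw [Fin.cons_succ, Fin.cons_succ]

theorem exists_lattice_of_mem_nodes {p : ℕ} (hp : 0 < p) (A : Fin 4 → Fin 3 → ℝ)
    (hA : AffineIndependent ℝ A) {N : Fin 3 → ℝ} (hN : N ∈ nodes p A) :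
    ∃ s ∈ lattice 3 p, ∀ i : Fin 3, eval N (bary A hA i.succ) = (s i : ℝ) / p := by
  obtain ⟨α, hα, rfl⟩ := hN
  have hp' : (p : ℝ) ≠ 0 := by positivity
  have hw : ∑ j, (α j : ℝ) / p = 1 := by
    rw [← sum_div, ← Nat.cast_sum, hα, div_self hp']
  refine ⟨Finsupp.equivFunOnFinite.symm fun i => α i.succ, ?_, fun i => ?_⟩
  · rw [Fin.sum_univ_succ] at hα
    change ∑ i : Fin 3, α i.succ ≤ p
    omega
  · rw [eval_bary_sum_vertex A hA _ hw]
    rfl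

/-- Polynomials of degree at most `p` agreeing on the nodal points of a tetrahedron are equal. -/
theorem eq_of_eval_nodes {p : ℕ} (hp : 0 < p) (A : Fin 4 → Fin 3 → ℝ)
    (hA : AffineIndependent ℝ A) {f g : MvPolynomial (Fin 3) ℝ} (hf : f.totalDegree ≤ p)
    (hg : g.totalDegree ≤ p) (h : ∀ N ∈ nodes p A, eval N f = eval N g) : f = g := by
  have h1 : aeval (pointPoly A) f = aeval (pointPoly A) g := by
    refine eq_of_eval_scaled_lattice hp
      ((totalDegree_aeval_le (totalDegree_pointPoly_le A) _).trans hf)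
      ((totalDegree_aeval_le (totalDegree_pointPoly_le A) _).trans hg) fun s hs => ?_
    rw [eval_aeval_pointPoly, eval_aeval_pointPoly]
    exact h _ (pointOf_mem_nodes hp A hs)
  refine MvPolynomial.funext fun y => ?_
  have h2 := congrArg (eval fun i : Fin 3 => eval y (bary A hA i.succ)) h1
  rwa [eval_aeval_pointPoly, eval_aeval_pointPoly, pointOf_bary] at h2

/-- Interpolation at the nodal points of a tetrahedron. -/
theorem exists_interpolant_nodes {p : ℕ} (hp : 0 < p) (A : Fin 4 → Fin 3 → ℝ)
    (hA : AffineIndependent ℝ A) (v : (Fin 3 → ℝ) → ℝ) :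
    ∃ f : MvPolynomial (Fin 3) ℝ, f.totalDegree ≤ p ∧ ∀ N ∈ nodes p A, eval N f = v N := by
  obtain ⟨g, hg, hv⟩ := exists_interpolant_scaled hp
    (fun s : Fin 3 →₀ ℕ => v (pointOf A fun i => (s i : ℝ) / p))
  refine ⟨aeval (fun i : Fin 3 => bary A hA i.succ) g,
    (totalDegree_aeval_le (fun i => totalDegree_bary_le A hA _) _).trans hg, fun N hN => ?_⟩
  obtain ⟨s, hs, e⟩ := exists_lattice_of_mem_nodes hp A hA hN
  have e' : (fun i : Fin 3 => eval N (bary A hA i.succ)) = fun i => (s i : ℝ) / p := funext e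
  have h1 : eval N (aeval (fun i : Fin 3 => bary A hA i.succ) g) =
      eval (fun i : Fin 3 => eval N (bary A hA i.succ)) g := by
    rw [← coe_aeval_eq_eval, ← coe_aeval_eq_eval, RingHom.coe_coe, RingHom.coe_coe,
      ← AlgHom.comp_apply, comp_aeval]
  rw [h1, e', hv s hs, ← e', pointOf_bary]

/-- Since d_refl(0) = 0, the family is empty for p = 0, and the division by p in the nodal points is
harmless. -/
theorem pos_of_lt_dRefl {p k : ℕ} (hk : k < dRefl p) : 0 < p := by
  unfold dRefl at hk
  omega

theorem existsUnique_isFacetOriented (p : ℕ) (A : Fin 4 → Fin 3 → ℝ)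
    (hA : AffineIndependent ℝ A) (i : Fin 4) (k : Fin (dRefl p)) :
    ∃! B : MvPolynomial (Fin 3) ℝ, IsFacetOriented p k A i B := by
  have hp := pos_of_lt_dRefl k.2
  -- The default value 0 is taken exactly at the points on no facet through A_i, as prescribed.
  obtain ⟨B, hB, hv⟩ := exists_interpolant_nodes hp A hA (patch A i (bRefl p k) 0)
  refine ⟨B, ⟨hB, fun N hN => ⟨fun a b ha hb hab x hx hNx => ?_, fun hN' => ?_⟩⟩, ?_⟩
  · rw [hv N hN]
    exact patch_eq A hA (eval_bRefl_swap p k) 0 ha hb hab hx hNx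
  · rw [hv N hN]
    refine dif_neg ?_
    rintro ⟨v, a, b, ha, hb, hab, x, hx, rfl, -⟩
    obtain ⟨j, hji, hja, hjb⟩ := exists_other i a b
    exact hN' j hji (triMap_mem_facet A hji.symm hja.symm hjb.symm hx)
  · rintro B' ⟨hB', h'⟩
    refine eq_of_eval_nodes hp A hA hB' hB fun N hN => ?_
    rw [hv N hN]
    by_cases h : ∃ v, IsPatchValue A i (bRefl p k) N v
    · obtain ⟨v, a, b, ha, hb, hab, x, hx, hNx, -⟩ := h
      rw [patch_eq A hA (eval_bRefl_swap p k) 0 ha hb hab hx hNx]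
      exact (h' N hN).1 a b ha hb hab x hx hNx
    · rw [patch, dif_neg h]
      refine (h' N hN).2 fun j hji hj => h ?_
      obtain ⟨a, b, ha, hb, hab, haj, hbj⟩ := exists_other_two i j hji
      obtain ⟨hx, hy⟩ := exists_of_mem_facet A hA hji.symm haj hbj ha.symm hb.symm hab hj
      exact ⟨_, a, b, ha, hb, hab, _, hx, hy, rfl⟩

/-- The coordinates of `triMap P Q R` as polynomials. -/
noncomputable def triPoly (P Q R : Fin 3 → ℝ) (m : Fin 3) : MvPolynomial (Fin 2) ℝ :=
  C (P m) + (C (Q m - P m) * X 0 + C (R m - P m) * X 1)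

theorem eval_aeval_triPoly (P Q R : Fin 3 → ℝ) (x : Fin 2 → ℝ) (f : MvPolynomial (Fin 3) ℝ) :
    eval x (aeval (triPoly P Q R) f) = eval (triMap P Q R x) f := by
  rw [← coe_aeval_eq_eval, ← coe_aeval_eq_eval, RingHom.coe_coe, RingHom.coe_coe,
    ← AlgHom.comp_apply, comp_aeval]
  congr 2
  ext m
  simp [triPoly, triMap]
  ring

theorem totalDegree_triPoly_le (P Q R : Fin 3 → ℝ) (m : Fin 3) :
    (triPoly P Q R m).totalDegree ≤ 1 :=
  totalDegree_add_le_of_le (by rw [totalDegree_C]; exact zero_le_one)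
    (totalDegree_add_le_of_le (totalDegree_C_mul_X_le _ _) (totalDegree_C_mul_X_le _ _))

theorem triMap_mem_nodes {p : ℕ} (hp : 0 < p) (A : Fin 4 → Fin 3 → ℝ) (a b c : Fin 4)
    {s : Fin 2 →₀ ℕ} (hs : s ∈ lattice 2 p) :
    triMap (A a) (A b) (A c) (fun i => (s i : ℝ) / p) ∈ nodes p A := by
  have hs' : s 0 + s 1 ≤ p := by
    have : ∑ i, s i ≤ p := hs
    rwa [Fin.sum_univ_two] at this
  have hp' : (p : ℝ) ≠ 0 := by positivity
  refine ⟨fun j => (if a = j then p - (s 0 + s 1) else 0) + (if b = j then s 0 else 0) +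
    (if c = j then s 1 else 0), ?_, ?_⟩
  · simp only [sum_add_distrib, sum_ite_eq, mem_univ, if_true]
    omega
  · ext m
    simp only [Nat.cast_add, Nat.cast_ite, Nat.cast_zero, add_div, ite_div, zero_div, add_smul,
      sum_add_distrib, ite_smul, zero_smul, sum_ite_eq, mem_univ, if_true]
    rw [Nat.cast_sub hs']
    simp [triMap]
    field_simp
    ring

/-- The restriction of a facet-oriented function to the facets through `A i`. -/
theorem IsFacetOriented.eval_triMap {p k : ℕ} (hk : k < dRefl p) {A : Fin 4 → Fin 3 → ℝ}
    {i : Fin 4} {B : MvPolynomial (Fin 3) ℝ} (hB : IsFacetOriented p k A i B) {a b : Fin 4}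
    (ha : a ≠ i) (hb : b ≠ i) (hab : a ≠ b) (x : Fin 2 → ℝ) :
    eval (triMap (A i) (A a) (A b) x) B = eval x (bRefl p k) := by
  have hp := pos_of_lt_dRefl hk
  -- Both sides have degree at most p and agree at the lattice points of the triangle, so nodal
  -- agreement becomes equality on the whole facet.
  have h : aeval (triPoly (A i) (A a) (A b)) B = bRefl p k := by
    refine eq_of_eval_scaled_lattice hp
      ((totalDegree_aeval_le (totalDegree_triPoly_le _ _ _) _).trans hB.1)
      (totalDegree_bRefl_le hk) fun s hs => ?_
    rw [eval_aeval_triPoly]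
    refine (hB.2 _ (triMap_mem_nodes hp A i a b hs)).1 a b ha hb hab _ ⟨by positivity,
      by positivity, ?_⟩ rfl
    have hs' : ∑ i, s i ≤ p := hs
    rw [Fin.sum_univ_two] at hs'
    rw [← add_div, div_le_one (by positivity)]
    exact_mod_cast hs'
  rw [← h, eval_aeval_triPoly]

theorem triMap_rotate {d : ℕ} (P Q R : Fin d → ℝ) (x : Fin 2 → ℝ) :
    triMap P Q R x = triMap Q R P ![x 1, 1 - x 0 - x 1] := by
  ext m
  simp [triMap]
  ring

theorem span_facetOriented {p : ℕ} {A : Fin 4 → Fin 3 → ℝ} (hA : AffineIndependent ℝ A)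
    {B : Fin 4 → Fin (dRefl p) → MvPolynomial (Fin 3) ℝ}
    (hB : ∀ (i : Fin 4) (k : Fin (dRefl p)), IsFacetOriented p k A i (B i k)) {j a b c : Fin 4}
    (ha : a ≠ j) (hb : b ≠ j) (hc : c ≠ j) (hab : a ≠ b) (hac : a ≠ c) (hbc : b ≠ c) :
    (Submodule.span ℝ {f : facet A j → ℝ | ∃ i : Fin 4, i ≠ j ∧ ∃ k : Fin (dRefl p),
        f = fun y : facet A j => eval (y : Fin 3 → ℝ) (B i k)} : Set (facet A j → ℝ)) =
      reflSpace p (facet A j) (A a) (A b) (A c) := by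
  let x : facet A j → Fin 2 → ℝ := fun y => ![eval (y : Fin 3 → ℝ) (bary A hA b),
    eval (y : Fin 3 → ℝ) (bary A hA c)]
  have hx : ∀ y : facet A j, x y ∈ refTriangle ∧
      (y : Fin 3 → ℝ) = triMap (A a) (A b) (A c) (x y) :=
    fun y => exists_of_mem_facet A hA ha hb hc hab hac hbc y.2
  have hx' : ∀ (z : Fin 2 → ℝ) (y : facet A j), (y : Fin 3 → ℝ) = triMap (A a) (A b) (A c) z →
      x y = z := by
    intro z y hy
    ext m
    fin_cases m
    · simp [x, hy, eval_bary_triMap, hab, hbc.symm]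
    · simp [x, hy, eval_bary_triMap, hac, hbc]
  -- Pullback along χ⁻¹, given by the barycentric coordinates at b and c. Both sides become images
  -- of spans under this linear map.
  let T : MvPolynomial (Fin 2) ℝ →ₗ[ℝ] (facet A j → ℝ) :=
    LinearMap.pi fun y => (aeval (x y)).toLinearMap
  have hT : ∀ u y, T u y = eval (x y) u := fun u y => by
    rw [← coe_aeval_eq_eval]
    rfl
  have hrefl : reflSpace p (facet A j) (A a) (A b) (A c) = (reflSpaceRef p).map T := by
    ext f
    constructor
    · rintro ⟨u, hu, h⟩
      refine ⟨u, hu, ?_⟩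
      ext y
      rw [hT, h _ (hx y).1 y (hx y).2]
    · rintro ⟨u, hu, rfl⟩
      refine ⟨u, hu, fun z _ y hy => ?_⟩
      rw [hT, hx' z y hy]
  have fa : ∀ k : Fin (dRefl p), (fun y : facet A j => eval (y : Fin 3 → ℝ) (B a k)) =
      T (bRefl p k) := by
    intro k
    ext y
    rw [hT, (hx y).2, (hB a k).eval_triMap k.2 hab.symm hac.symm hbc]
  have fb : ∀ k : Fin (dRefl p), (fun y : facet A j => eval (y : Fin 3 → ℝ) (B b k)) =
      T (rotRM (bRefl p k)) := by
    intro k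
    ext y
    rw [hT, eval_rotRM, (hx y).2, triMap_rotate,
      (hB b k).eval_triMap k.2 hbc.symm hab hac.symm]
  have fc : ∀ k : Fin (dRefl p), (fun y : facet A j => eval (y : Fin 3 → ℝ) (B c k)) =
      T (rotMR (bRefl p k)) := by
    intro k
    ext y
    rw [hT, ← rotRM_rotRM, eval_rotRM, eval_rotRM, (hx y).2, triMap_rotate, triMap_rotate,
      (hB c k).eval_triMap k.2 hac hbc hab]
  have huniv := univ_eq_of_distinct ha hb hc hab hac hbc
  rw [hrefl, reflSpaceRef, Submodule.map_span]
  congr 1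
  refine le_antisymm (Submodule.span_le.mpr ?_) (Submodule.span_mono ?_)
  · rintro _ ⟨i, hi, k, rfl⟩
    have hi' : i ∈ ({j, a, b, c} : Finset (Fin 4)) := huniv ▸ mem_univ i
    simp only [mem_insert, mem_singleton] at hi'
    have hb' : T (rotRM (bRefl p k)) ∈ Submodule.span ℝ (T ''
        (Set.range (fun k : Fin (dRefl p) => rotRM (bRefl p k)) ∪
          Set.range (fun k : Fin (dRefl p) => rotMR (bRefl p k)))) :=
      Submodule.subset_span ⟨_, Or.inl ⟨k, rfl⟩, rfl⟩
    have hc' : T (rotMR (bRefl p k)) ∈ Submodule.span ℝ (T ''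
        (Set.range (fun k : Fin (dRefl p) => rotRM (bRefl p k)) ∪
          Set.range (fun k : Fin (dRefl p) => rotMR (bRefl p k)))) :=
      Submodule.subset_span ⟨_, Or.inr ⟨k, rfl⟩, rfl⟩
    rcases hi' with rfl | rfl | rfl | rfl
    · exact absurd rfl hi
    · rw [fa]
      have e : bRefl p k = -(rotRM (bRefl p k)) - rotMR (bRefl p k) := by
        linear_combination bRefl_add_rot p k
      rw [e, map_sub, map_neg]
      exact Submodule.sub_mem _ (Submodule.neg_mem _ hb') hc'
    · rw [fb]
      exact hb'
    · rw [fc]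
      exact hc'
  · rintro _ ⟨_, ⟨k, rfl⟩ | ⟨k, rfl⟩, rfl⟩
    · exact ⟨b, hb, k, (fb k).symm⟩
    · exact ⟨c, hc, k, (fc k).symm⟩

end

/-! ### Linear independence of the surface functions. -/

section

open MvPolynomial Finset

theorem IsTotallySymmetric.rotMR_eq {w : MvPolynomial (Fin 2) ℝ} (hw : IsTotallySymmetric w) :
    rotMR w = w := by
  refine eq_of_eval_eq_on_refTriangle fun x hx => ?_
  rw [eval_rotMR, ← hw (finRotate 3) x hx]
  congr 2
  ext m
  fin_cases m <;> simp [triMap, refVertex]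
  ring

/-- Three functions of reflection type on a triangle with all rotated sums zero coincide. -/
theorem eq_of_rotated_sums {f g h : MvPolynomial (Fin 2) ℝ}
    (hg : g + rotRM g + rotMR g = 0) (hh : h + rotRM h + rotMR h = 0)
    (h1 : f + rotRM g + rotMR h = 0) (h2 : f + rotRM h + rotMR g = 0) : g = h := by
  set u := g - h with hu
  have hu1 : rotRM u = rotMR u := by
    simp only [hu, map_sub]
    linear_combination h1 - h2
  have hu2 : rotRM u = u := by
    have := congrArg rotMR hu1
    rw [rotMR_rotRM, ← rotRM_rotRM (rotMR u), rotRM_rotMR] at this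
    exact this.symm
  have hu3 : u + rotRM u + rotMR u = 0 := by
    simp only [hu, map_sub]
    linear_combination hg - hh
  rw [← hu1, hu2] at hu3
  have h4 : (3 : MvPolynomial (Fin 2) ℝ) * u = 0 := by linear_combination hu3
  exact sub_eq_zero.mp ((mul_eq_zero.mp h4).resolve_left (by norm_num))

theorem linearIndependent_surfaceFun {p : ℕ} {A : Fin 4 → Fin 3 → ℝ}
    {Q : Fin 4 → Fin (dRefl p) → surface A → ℝ}
    (hQ : ∀ (i : Fin 4) (k : Fin (dRefl p)), IsReflSurfaceFun p k A i (Q i k)) :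
    LinearIndependent ℝ (fun ik : Fin 4 × Fin (dRefl p) => Q ik.1 ik.2) := by
  rw [Fintype.linearIndependent_iff]
  intro c hc
  have hQ2 := fun i k => (hQ i k).2
  choose w _ hsymm hedge hval using hQ2
  set β : Fin 4 → MvPolynomial (Fin 2) ℝ := fun i => ∑ k, c (i, k) • bRefl p k with hβ
  set W : Fin 4 → MvPolynomial (Fin 2) ℝ := fun i => ∑ k, c (i, k) • w i k with hW
  have eval_comb : ∀ (i : Fin 4) (f : Fin (dRefl p) → MvPolynomial (Fin 2) ℝ) (x : Fin 2 → ℝ),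
      eval x (∑ k, c (i, k) • f k) = ∑ k, c (i, k) * eval x (f k) := fun i f x => by
    simp only [map_sum, smul_eval]
  have hrot : ∀ i, β i + rotRM (β i) + rotMR (β i) = 0 := by
    intro i
    simp only [hβ, map_sum, map_smul, ← sum_add_distrib, ← smul_add, bRefl_add_rot, smul_zero,
      sum_const_zero]
  have hWrot : ∀ i, rotMR (W i) = W i := by
    intro i
    simp only [hW, map_sum, map_smul, (hsymm i _).rotMR_eq]
  have hfacet : ∀ j a b e : Fin 4, a ≠ j → b ≠ j → e ≠ j → a ≠ b → a ≠ e → b ≠ e →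
      β a + rotRM (β b) + rotMR (β e) + W j = 0 := by
    intro j a b e ha hb he hab hae hbe
    refine eq_of_eval_eq_on_refTriangle fun x hx => ?_
    have hx1 : ![x 1, 1 - x 0 - x 1] ∈ refTriangle := by
      obtain ⟨h0, h1, h2⟩ := hx
      refine ⟨by simpa, ?_, ?_⟩ <;> simp <;> linarith
    have hx2 : ![1 - x 0 - x 1, x 0] ∈ refTriangle := by
      obtain ⟨h0, h1, h2⟩ := hx
      refine ⟨?_, by simpa, ?_⟩ <;> simp <;> linarith
    let y : surface A := ⟨triMap (A a) (A b) (A e) x,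
      Set.mem_iUnion.mpr ⟨j, triMap_mem_facet A ha hb he hx⟩⟩
    have hsum := congrFun hc y
    rw [Finset.sum_apply, Fintype.sum_prod_type, univ_eq_of_distinct ha hb he hab hae hbe,
      sum_insert (by simp [ha.symm, hb.symm, he.symm]), sum_insert (by simp [hab, hae]),
      sum_insert (by simp [hbe]), sum_singleton] at hsum
    simp only [Pi.smul_apply, smul_eq_mul, Pi.zero_apply] at hsum
    have va : ∀ k, Q a k y = eval x (bRefl p k) := fun k =>
      (hQ a k).1 b e hab.symm hae.symm hbe x hx y rfl
    have vb : ∀ k, Q b k y = eval ![x 1, 1 - x 0 - x 1] (bRefl p k) := fun k =>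
      (hQ b k).1 e a hbe.symm hab hae.symm _ hx1 y (triMap_rotate _ _ _ _)
    have ve : ∀ k, Q e k y = eval ![1 - x 0 - x 1, x 0] (bRefl p k) := fun k =>
      (hQ e k).1 a b hae hbe hab _ hx2 y (by
        change triMap (A a) (A b) (A e) x = _
        rw [triMap_rotate, triMap_rotate]
        congr 1
        ext m
        fin_cases m <;> simp)
    have vj : ∀ k, Q j k y = eval x (w j k) := fun k =>
      hval j k a b e ha hb he hab hae hbe x hx y rfl
    simp only [va, vb, ve, vj, ← eval_comb] at hsum
    rw [map_zero, map_add, map_add, map_add, eval_rotRM, eval_rotMR]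
    linear_combination hsum
  have hW0 : ∀ j, W j = 0 := by
    intro j
    obtain ⟨a, b, e, ha, hb, he, hab, hae, hbe⟩ : ∃ a b e : Fin 4, a ≠ j ∧ b ≠ j ∧ e ≠ j ∧ a ≠ b ∧
        a ≠ e ∧ b ≠ e := by revert j; decide
    have h0 := hfacet j a b e ha hb he hab hae hbe
    have hWrot' : rotRM (W j) = W j := by
      conv_lhs => rw [← hWrot j, rotRM_rotMR]
    have h1 := congrArg rotRM h0
    have h2 := congrArg rotMR h0
    simp only [map_add, map_zero, hWrot, hWrot', rotRM_rotRM, rotRM_rotMR, rotMR_rotRM] at h1 h2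
    have h3 : rotMR (rotMR (β e)) = rotRM (β e) := by
      rw [← rotRM_rotRM (rotMR (β e)), rotRM_rotMR]
    rw [h3] at h2
    -- In the sum of the three rotated relations each of β_a, β_b, β_e occurs with all its rotates.
    have h4 : (3 : MvPolynomial (Fin 2) ℝ) * W j = 0 := by
      linear_combination h0 + h1 + h2 - hrot a - hrot b - hrot e
    exact (mul_eq_zero.mp h4).resolve_left (by norm_num)
  have hfacet0 : ∀ a b e : Fin 4, a ≠ b → a ≠ e → b ≠ e →
      β a + rotRM (β b) + rotMR (β e) = 0 := by
    intro a b e hab hae hbe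
    obtain ⟨j, hja, hjb, hje⟩ := exists_other a b e
    simpa [hW0] using hfacet j a b e hja.symm hjb.symm hje.symm hab hae hbe
  have hall : ∀ b e, b ≠ e → β b = β e := by
    intro b e hbe
    obtain ⟨a, hab, hae, -⟩ := exists_other b e e
    exact eq_of_rotated_sums (hrot b) (hrot e) (hfacet0 a b e hab hae hbe)
      (hfacet0 a e b hae hab hbe.symm)
  rintro ⟨i, k⟩
  have hp := pos_of_lt_dRefl k.2
  -- Orthogonality together with zero edge values suffices; the latter follow from `hW0` because
  -- `hedge` identifies β_i with W_i on the edge.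
  have hβ0 : β i = 0 := by
    refine eq_zero_of_orthogonal_of_edge (p := p) ?_ ?_ ?_
    · exact totalDegree_finsetSum_le fun k _ =>
        (totalDegree_smul_le _ _).trans (totalDegree_bRefl_le k.2)
    · intro q hq
      rw [hβ, sum_mul]
      change triIntegralₗ _ = 0
      rw [map_sum]
      refine sum_eq_zero fun k _ => ?_
      rw [smul_mul_assoc, map_smul]
      change _ • triIntegral _ = 0
      rw [triIntegral_bRefl_mul k.2 hq, smul_zero]
    · intro t ht
      have h1 := congrArg (eval ![t, 1 - t]) (hW0 i)
      rw [map_zero, hW, eval_comb] at h1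
      rw [hβ, eval_comb, ← h1]
      exact sum_congr rfl fun k _ => by rw [hedge i k t ht]
  exact Fintype.linearIndependent_iff.mp (linearIndependent_bRefl p) (fun k => c (i, k)) hβ0 k

end

end ReflSurface

theorem mainTheorem5 (p : ℕ) (A : Fin 4 → Fin 3 → ℝ) (hA : AffineIndependent ℝ A) :
    -- the surface functions exist, and every choice of them is linearly independent
    (∀ (i : Fin 4) (k : Fin (dRefl p)), ∃ Q : surface A → ℝ, IsReflSurfaceFun p k A i Q) ∧
    (∀ Q : Fin 4 → Fin (dRefl p) → surface A → ℝ,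
      (∀ (i : Fin 4) (k : Fin (dRefl p)), IsReflSurfaceFun p k A i (Q i k)) →
      LinearIndependent ℝ (fun ik : Fin 4 × Fin (dRefl p) => Q ik.1 ik.2)) ∧
    -- the facet-oriented functions exist and are unique, and their restrictions to each facet
    -- span the reflection-type space
    (∀ (i : Fin 4) (k : Fin (dRefl p)),
      ∃! B : MvPolynomial (Fin 3) ℝ, IsFacetOriented p k A i B) ∧
    (∀ B : Fin 4 → Fin (dRefl p) → MvPolynomial (Fin 3) ℝ,
      (∀ (i : Fin 4) (k : Fin (dRefl p)), IsFacetOriented p k A i (B i k)) →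
      ∀ j a b c : Fin 4, a ≠ j → b ≠ j → c ≠ j → a ≠ b → a ≠ c → b ≠ c →
        (Submodule.span ℝ {f : facet A j → ℝ | ∃ i : Fin 4, i ≠ j ∧ ∃ k : Fin (dRefl p),
            f = fun y : facet A j => MvPolynomial.eval (y : Fin 3 → ℝ) (B i k)} : Set (facet A j → ℝ)) =
          reflSpace p (facet A j) (A a) (A b) (A c)) := by
  exact ⟨exists_isReflSurfaceFun p A hA, fun _ hQ => linearIndependent_surfaceFun hQ,
    existsUnique_isFacetOriented p A hA, fun _ hB _ _ _ _ ha hb hc hab hac hbc =>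
      span_facetOriented hA hB ha hb hc hab hac hbc⟩
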